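/- Let $H_{2n}$ be the Heisenberg group of dimension $4n+1$, i.e. the simply connected Lie group whose Lie algebra has a basis $X_1,\dots,X_{2n},Y_1,\dots,Y_{2n},Z$ with $[X_i,Y_i]=Z$ and all other brackets of basis vectors zero, and let $N=H_{2n}\times\mathbf R^3$. Let $\Gamma$ be a cocompact lattice (a discrete subgroup with compact quotient $\Gamma\backslash H_{2n}$) in $H_{2n}$, and let $\Lambda\cong\mathbf Z^3$ be a lattice in $\mathbf R^3$, for instance $\Lambda=\mathbf Z^3$. Then $(\Gamma\times\Lambda)\backslash N$ is a compact (Hausdorff) smooth manifold, the projection $N\to(\Gamma\times\Lambda)\backslash N$ being a local diffeomorphism, and it admits an HKT structure $(I_1,I_2,I_3,g)$ that is induced by left-invariant tensors on $N$: under the projection, $I_1,I_2,I_3$ and $g$ lift to left-invariant complex structures $I_1',I_2',I_3'$ and a left-invariant metric $g'$ on $N$, where each $I_a'$ is Abelian, i.e. $[I_a'X,I_a'Y]=[X,Y]$ for all $X,Y$ in the Lie algebra of $N$. Here an HKT structure on a manifold consists of integrable complex structures $I_1,I_2,I_3$ with $I_1I_2=I_3=-I_2I_1$ and a Riemannian metric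 $g$ with $g(I_aX,I_aY)=g(X,Y)$ for $a=1,2,3$ such that there is a linear connection $\nabla$ with $\nabla g=0$, $\nabla I_1=\nabla I_2=\nabla I_3=0$, whose torsion $T$ is totally skew-symmetric, i.e. $c(X,Y,Z)=g(X,T(Y,Z))$ is a $3$-form. -/

import Mathlib

open Bundle
open scoped Manifold ContDiff

noncomputable section

/-! ### Hypercomplex, hyper-Hermitian and HKT structures on a smooth manifold -/

namespace HKT

/-- The family of tangent spaces of a manifold `M` modelled on the vector space `E`. -/
abbrev Tan (E : Type) [NormedAddCommGroup E] [NormedSpace ℝ E]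
    (M : Type) [TopologicalSpace M] [ChartedSpace E M] : M → Type :=
  fun x => TangentSpace 𝓘(ℝ, E) x

/-- A (not necessarily smooth) field of endomorphisms of the tangent spaces. -/
abbrev EndoField (E : Type) [NormedAddCommGroup E] [NormedSpace ℝ E]
    (M : Type) [TopologicalSpace M] [ChartedSpace E M] : Type :=
  (x : M) → Tan E M x →L[ℝ] Tan E M x

/-- A smooth Riemannian metric on `M`. -/
abbrev Metric (E : Type) [NormedAddCommGroup E] [NormedSpace ℝ E]
    (M : Type) [TopologicalSpace M] [ChartedSpace E M] [IsManifold 𝓘(ℝ, E) ∞ M] : Type :=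
  ContMDiffRiemannianMetric 𝓘(ℝ, E) ∞ E (Tan E M)

/-- A linear connection on `M`, i.e. a covariant derivative on the tangent bundle; the vector
`conn Y x v` is `∇_v Y` at `x`. -/
abbrev Connection (E : Type) [NormedAddCommGroup E] [NormedSpace ℝ E]
    (M : Type) [TopologicalSpace M] [ChartedSpace E M] [IsManifold 𝓘(ℝ, E) ∞ M] : Type :=
  CovariantDerivative 𝓘(ℝ, E) E (Tan E M)

section

variable {E : Type} [NormedAddCommGroup E] [NormedSpace ℝ E]
  {M : Type} [TopologicalSpace M] [ChartedSpace E M]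

variable [IsManifold 𝓘(ℝ, E) ∞ M]

/-- A vector field is differentiable at the point `x`. -/
def DiffAt (Y : (x : M) → Tan E M x) (x : M) : Prop :=
  MDifferentiableAt 𝓘(ℝ, E) 𝓘(ℝ, E).tangent (fun y => TotalSpace.mk' E (E := Tan E M) y (Y y)) x

/-- An (integrable) complex structure on `M`: a smooth field `J` of endomorphisms of the tangent
bundle with `J² = -1` such that around each point there are smooth coordinates, with values in the
model vector space `E`, that carry `J` to a constant endomorphism `J₀` of `E`, i.e. holomorphic
coordinates with values in the complex vector space `(E, J₀)`. -/
structure IsComplexStructure (J : EndoField E M) : Prop where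
  smooth : ContMDiff 𝓘(ℝ, E) (𝓘(ℝ, E).prod 𝓘(ℝ, E →L[ℝ] E)) ∞
    (fun x => TotalSpace.mk' (E →L[ℝ] E) (E := fun x : M => Tan E M x →L[ℝ] Tan E M x) x (J x))
  sq : ∀ (x : M) (v : Tan E M x), J x (J x v) = -v
  integrable : ∀ p : M, ∃ φ ∈ IsManifold.maximalAtlas 𝓘(ℝ, E) ∞ M, p ∈ φ.source ∧
    ∃ J₀ : E →L[ℝ] E, ∀ x ∈ φ.source, ∀ v : Tan E M x,
      mfderiv 𝓘(ℝ, E) 𝓘(ℝ, E) φ x (J x v) = J₀ (mfderiv 𝓘(ℝ, E) 𝓘(ℝ, E) φ x v)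

/-- Three complex structures `I₁, I₂, I₃` (here `I 0, I 1, I 2`) form a hypercomplex structure if
`I₁ I₂ = I₃ = - I₂ I₁`. -/
structure IsHypercomplex (I : Fin 3 → EndoField E M) : Prop where
  complex : ∀ a, IsComplexStructure (I a)
  mul : ∀ (x : M) (v : Tan E M x), I 0 x (I 1 x v) = I 2 x v
  mul_swap : ∀ (x : M) (v : Tan E M x), I 1 x (I 0 x v) = -I 2 x v

/-- `(M, I, g)` is a hyper-Hermitian manifold. -/
structure IsHyperHermitian (I : Fin 3 → EndoField E M) (g : Metric E M) : Prop where
  hypercomplex : IsHypercomplex I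
  hermitian : ∀ (a : Fin 3) (x : M) (v w : Tan E M x),
    g.inner x (I a x v) (I a x w) = g.inner x v w

/-- `∇ g = 0`: `v (g(Y, Z)) = g(∇_v Y, Z) + g(Y, ∇_v Z)`. -/
def PreservesMetric (conn : Connection E M) (g : Metric E M) : Prop :=
  ∀ (x : M) (Y Z : (x : M) → Tan E M x), DiffAt Y x → DiffAt Z x → ∀ v : Tan E M x,
    mvfderiv 𝓘(ℝ, E) (fun y => g.inner y (Y y) (Z y)) x v =
      g.inner x (conn Y x v) (Z x) + g.inner x (Y x) (conn Z x v)

/-- `∇ J = 0`: `∇_v (J Y) = J (∇_v Y)`. -/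
def PreservesEndo (conn : Connection E M) (J : EndoField E M) : Prop :=
  ∀ (x : M) (Y : (x : M) → Tan E M x), DiffAt Y x → ∀ v : Tan E M x,
    conn (fun y => J y (Y y)) x v = J x (conn Y x v)

/-- The torsion tensor `c(u, v, w) = g(u, T(v, w))` is totally skew-symmetric, where
`T(X, Y) = ∇_X Y - ∇_Y X - [X, Y]`. -/
def HasSkewTorsion [FiniteDimensional ℝ E] (conn : Connection E M) (g : Metric E M) : Prop :=
  haveI : CompleteSpace E := FiniteDimensional.complete ℝ E
  ∀ (x : M) (u v w : Tan E M x),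
    g.inner x u (conn.torsion x v w) = -g.inner x v (conn.torsion x u w) ∧
    g.inner x u (conn.torsion x v w) = -g.inner x u (conn.torsion x w v)

/-- A hyper-Kähler connection (with torsion), or HKT connection: a smooth linear connection that
preserves the metric and the three complex structures and has totally skew-symmetric torsion. -/
structure IsHKTConnection [FiniteDimensional ℝ E] (I : Fin 3 → EndoField E M) (g : Metric E M)
    (conn : Connection E M) : Prop where
  smooth : CovariantDerivative.ContMDiffCovariantDerivative conn ∞
  metric : PreservesMetric conn g
  endo : ∀ a, PreservesEndo conn (I a)
  skew : HasSkewTorsion conn g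

/-- `(M, I, g)` is an HKT structure: it is hyper-Hermitian and admits an HKT connection. -/
def IsHKT [FiniteDimensional ℝ E] (I : Fin 3 → EndoField E M) (g : Metric E M) : Prop :=
  IsHyperHermitian I g ∧ ∃ conn : Connection E M, IsHKTConnection I g conn

end

section LeftInvariant

variable {E : Type} [NormedAddCommGroup E] [NormedSpace ℝ E]
  {G : Type} [TopologicalSpace G] [ChartedSpace E G] [Group G]

/-- The endomorphism field `J` on the Lie group `G` is invariant under all left translations. -/
def EndoField.IsLeftInvariant (J : EndoField E G) : Prop :=
  ∀ (a x : G) (v : Tan E G x),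
    mfderiv 𝓘(ℝ, E) 𝓘(ℝ, E) (fun y => a * y) x (J x v) =
      J (a * x) (mfderiv 𝓘(ℝ, E) 𝓘(ℝ, E) (fun y => a * y) x v)

/-- The left-invariant endomorphism field `J` on the Lie group `G` is Abelian: on the Lie algebra
of `G`, `[J v, J w] = [v, w]`. -/
def EndoField.IsAbelian (J : EndoField E G) : Prop :=
  ∀ v w : GroupLieAlgebra 𝓘(ℝ, E) G,
    ⁅(J 1 v : GroupLieAlgebra 𝓘(ℝ, E) G), (J 1 w : GroupLieAlgebra 𝓘(ℝ, E) G)⁆ = ⁅v, w⁆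

/-- The metric `g` on the Lie group `G` is invariant under all left translations. -/
def IsLeftInvariantMetric [IsManifold 𝓘(ℝ, E) ∞ G] (g : Metric E G) : Prop :=
  ∀ (a x : G) (v w : Tan E G x),
    g.inner (a * x) (mfderiv 𝓘(ℝ, E) 𝓘(ℝ, E) (fun y => a * y) x v)
      (mfderiv 𝓘(ℝ, E) 𝓘(ℝ, E) (fun y => a * y) x w) = g.inner x v w

end LeftInvariant

/-! ### The Heisenberg group and its product with `ℝ³` -/

/-- The Heisenberg group `H_{2n}` of dimension `4n + 1`, in exponential coordinates: `(x, y, z)`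
stands for `exp (∑ xᵢ Xᵢ + ∑ yᵢ Yᵢ + z Z)`, where `[Xᵢ, Yᵢ] = Z` (`i = 1, …, 2n`) are the only
nonzero brackets of basis vectors. -/
def Heis (n : ℕ) : Type := (Fin (2 * n) → ℝ) × (Fin (2 * n) → ℝ) × ℝ

namespace Heis

variable {n : ℕ}

instance : TopologicalSpace (Heis n) :=
  inferInstanceAs (TopologicalSpace ((Fin (2 * n) → ℝ) × (Fin (2 * n) → ℝ) × ℝ))

/-- The multiplication given by the Baker-Campbell-Hausdorff formula, `u + v + [u, v] / 2`. -/
def mul (p q : Heis n) : Heis n :=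
  (p.1 + q.1, p.2.1 + q.2.1,
    p.2.2 + q.2.2 + (∑ i, (p.1 i * q.2.1 i - p.2.1 i * q.1 i)) / 2)

instance : Mul (Heis n) := ⟨mul⟩

instance : One (Heis n) := ⟨((0, 0, 0) : (Fin (2 * n) → ℝ) × (Fin (2 * n) → ℝ) × ℝ)⟩

instance : Inv (Heis n) := ⟨fun p => (-p.1, -p.2.1, -p.2.2)⟩

instance : Group (Heis n) :=
  Group.ofLeftAxioms
    (by
      intro p q r
      refine Prod.ext (add_assoc p.1 q.1 r.1)
        (Prod.ext (add_assoc p.2.1 q.2.1 r.2.1) ?_)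
      change p.2.2 + q.2.2 + (∑ i, (p.1 i * q.2.1 i - p.2.1 i * q.1 i)) / 2 + r.2.2 +
          (∑ i, ((p.1 i + q.1 i) * r.2.1 i - (p.2.1 i + q.2.1 i) * r.1 i)) / 2 =
        p.2.2 + (q.2.2 + r.2.2 + (∑ i, (q.1 i * r.2.1 i - q.2.1 i * r.1 i)) / 2) +
          (∑ i, (p.1 i * (q.2.1 i + r.2.1 i) - p.2.1 i * (q.1 i + r.1 i))) / 2
      simp only [Finset.sum_sub_distrib, mul_add, add_mul, Finset.sum_add_distrib]
      ring)
    (by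
      intro p
      refine Prod.ext (zero_add p.1) (Prod.ext (zero_add p.2.1) ?_)
      change 0 + p.2.2 + (∑ i, (0 * p.2.1 i - 0 * p.1 i)) / 2 = p.2.2
      simp)
    (by
      intro p
      refine Prod.ext (neg_add_cancel p.1) (Prod.ext (neg_add_cancel p.2.1) ?_)
      change -p.2.2 + p.2.2 + (∑ i, (-p.1 i * p.2.1 i - -p.2.1 i * p.1 i)) / 2 = 0
      simp [mul_comm])

end Heis

/-- The vector space underlying `N = H_{2n} × ℝ³` in exponential coordinates. -/
abbrev NilVec (n : ℕ) : Type :=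
  ((Fin (2 * n) → ℝ) × (Fin (2 * n) → ℝ) × ℝ) × (Fin 3 → ℝ)

/-- The nilpotent Lie group `N = H_{2n} × ℝ³`, of dimension `4n + 4`. -/
def NilGroup (n : ℕ) : Type := Heis n × Multiplicative (Fin 3 → ℝ)

namespace NilGroup

variable {n : ℕ}

instance : Group (NilGroup n) := inferInstanceAs (Group (Heis n × Multiplicative (Fin 3 → ℝ)))

instance : TopologicalSpace (NilGroup n) := inferInstanceAs (TopologicalSpace (NilVec n))

/-- The smooth structure of `N` is given by the one global exponential chart. -/
instance : ChartedSpace (NilVec n) (NilGroup n) :=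
  inferInstanceAs (ChartedSpace (NilVec n) (NilVec n))

instance : IsManifold 𝓘(ℝ, NilVec n) ∞ (NilGroup n) :=
  inferInstanceAs (IsManifold 𝓘(ℝ, NilVec n) ∞ (NilVec n))

theorem contDiff_mul : ContDiff ℝ ∞ (fun p : NilVec n × NilVec n =>
    ((((p.1.1.1 + p.2.1.1, p.1.1.2.1 + p.2.1.2.1,
      p.1.1.2.2 + p.2.1.2.2 + (∑ i, (p.1.1.1 i * p.2.1.2.1 i - p.1.1.2.1 i * p.2.1.1 i)) / 2),
      p.1.2 + p.2.2) : NilVec n))) := by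
  fun_prop

theorem contDiff_inv : ContDiff ℝ ∞ (fun p : NilVec n =>
    (((-p.1.1, -p.1.2.1, -p.1.2.2), -p.2) : NilVec n)) := by
  fun_prop

instance : LieGroup 𝓘(ℝ, NilVec n) ∞ (NilGroup n) where
  contMDiff_mul := by
    have h := (contDiff_mul (n := n)).contMDiff
    rw [modelWithCornersSelf_prod, ← chartedSpaceSelf_prod] at h
    exact h
  contMDiff_inv := (contDiff_inv (n := n)).contMDiff

end NilGroup

/-- The subgroup `Γ × Λ` of `N = H_{2n} × ℝ³`. -/
def latticeProd {n : ℕ} (Γ : Subgroup (Heis n)) (Λ : Submodule ℤ (Fin 3 → ℝ)) :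
    Subgroup (NilGroup n) :=
  Subgroup.prod Γ (AddSubgroup.toSubgroup Λ.toAddSubgroup)

/-- The space `(Γ × Λ) \ N` of orbits of `Γ × Λ` acting on `N` by left multiplication, with the
quotient topology. -/
abbrev Nilmanifold {n : ℕ} (Γ : Subgroup (Heis n)) (Λ : Submodule ℤ (Fin 3 → ℝ)) : Type :=
  MulAction.orbitRel.Quotient (latticeProd Γ Λ) (NilGroup n)

/-- The projection `N → (Γ × Λ) \ N`. -/
def Nilmanifold.proj {n : ℕ} (Γ : Subgroup (Heis n)) (Λ : Submodule ℤ (Fin 3 → ℝ)) :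
    NilGroup n → Nilmanifold Γ Λ :=
  Quotient.mk _

end HKT

end

/-! All the data are determined on the Lie algebra. Write `[v, w] = ω(v, w) Z`, let `θ` be the form
dual to `Z`, and let `J` be the skew endomorphism with `⟨J v, w⟩ = ω(v, w)`. Identify the horizontal
part with `ℂ²ⁿ`, so that `J` is multiplication by `i`, and let the unit quaternions act there
through `SU(2)`. On the span of `Z` and `ℝ³`, viewed as the quaternions with `Z = 1`, let them act
by left multiplication. The resulting `I_a` are orthogonal and commute with `J`, hence preserve `ω`;
this is the Abelian condition (`omega_quat`).

Integrability comes from explicit coordinates. Since `ω(·, I ·)` is symmetric and `I Z` lies in the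
radical of `ω`, the quadratic shear `u ↦ u - (ω(u, I u) / 4) I Z` is a diffeomorphism carrying the
left-invariant `I` to the constant one (`fderiv_holCoord_intertwines`).

The connection is `∇_v w = -θ(v) J w` on left-invariant fields. It preserves `g` because `J` is
skew, and each `I_a` because `J` commutes with it. The bracket contributes only `-θ(u) ω(v, w)` to
`⟨u, T(v, w)⟩`; the two `J` terms supply the other cyclic terms, so the torsion form is `-θ ∧ ω`
(`inner₀_torsion`).

To treat `N` and its quotient together, the geometry is built on any manifold whose charts differ
locally by left translations. Invariance of the Maurer-Cartan form then makes `coframe` a global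
parallelism, computable in every atlas chart (`coframe_eq`). The projection from `N` respects the
coframes (`coframe_mfderiv_proj`), so the tensors on the quotient lift to those on `N`. -/

noncomputable section

namespace HKT

/-! ### Linear algebra on the Lie algebra of `N` -/

namespace NilVec

variable {n : ℕ}

/-- The central vector `Z`. -/
def center : NilVec n := ((0, 0, 1), 0)

/-- The bilinear form `ω` with `[v, w] = ω(v, w) Z`. -/
def omega : NilVec n →L[ℝ] NilVec n →L[ℝ] ℝ :=
  LinearMap.toContinuousLinearMap (LinearMap.toContinuousLinearMap.toLinearMap ∘ₗ
    LinearMap.mk₂ ℝ (fun v w : NilVec n => ∑ i, (v.1.1 i * w.1.2.1 i - v.1.2.1 i * w.1.1 i))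
      (by intro v v' w; simp [Finset.sum_add_distrib, add_mul]; ring)
      (by intro c v w; simp [Finset.mul_sum, mul_sub, mul_assoc])
      (by intro v w w'; simp [Finset.sum_add_distrib, mul_add]; ring)
      (by intro c v w; simp [Finset.mul_sum, mul_sub, mul_left_comm]))

theorem omega_apply (v w : NilVec n) :
    omega v w = ∑ i, (v.1.1 i * w.1.2.1 i - v.1.2.1 i * w.1.1 i) := rfl

/-- The inner product for which the standard basis is orthonormal. -/
def inner₀ : NilVec n →L[ℝ] NilVec n →L[ℝ] ℝ :=
  LinearMap.toContinuousLinearMap (LinearMap.toContinuousLinearMap.toLinearMap ∘ₗ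
    LinearMap.mk₂ ℝ (fun v w : NilVec n => ∑ i, (v.1.1 i * w.1.1 i + v.1.2.1 i * w.1.2.1 i) +
        (v.1.2.2 * w.1.2.2 + ∑ j, v.2 j * w.2 j))
      (by intro v v' w; simp [Finset.sum_add_distrib, add_mul]; ring)
      (by intro c v w; simp [Finset.sum_add_distrib, Finset.mul_sum, mul_add, mul_assoc])
      (by intro v w w'; simp [Finset.sum_add_distrib, mul_add]; ring)
      (by intro c v w; simp [Finset.sum_add_distrib, Finset.mul_sum, mul_add, mul_left_comm]))

theorem inner₀_apply (v w : NilVec n) :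
    inner₀ v w = ∑ i, (v.1.1 i * w.1.1 i + v.1.2.1 i * w.1.2.1 i) +
        (v.1.2.2 * w.1.2.2 + ∑ j, v.2 j * w.2 j) := rfl

/-- The linear form dual to `Z`. -/
def theta : NilVec n →L[ℝ] ℝ :=
  ContinuousLinearMap.snd ℝ _ _ ∘L ContinuousLinearMap.snd ℝ _ _ ∘L ContinuousLinearMap.fst ℝ _ _

theorem theta_apply (v : NilVec n) : theta v = v.1.2.2 := rfl

/-- The endomorphism `J` with `⟨J v, w⟩ = ω(v, w)`. -/
def rot : NilVec n →L[ℝ] NilVec n :=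
  LinearMap.toContinuousLinearMap
    { toFun := fun v => ((-v.1.2.1, v.1.1, 0), 0)
      map_add' := by intro v w; simp [add_comm]
      map_smul' := by intro c v; simp }

theorem rot_apply (v : NilVec n) : rot v = ((-v.1.2.1, v.1.1, 0), 0) := rfl

/-- The sign `±1` distinguishing the two halves of the index set. -/
def sgn (i : Fin (2 * n)) : ℝ := if (i : ℕ) < n then 1 else -1

theorem sgn_mul_self (i : Fin (2 * n)) : sgn i * sgn i = 1 := by
  unfold sgn; split_ifs <;> norm_num

/-- Reversal exchanges the two halves of the index set, which needs an even number of pairs. This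
sign change makes the horizontal parts of `quat 0` and `quat 1` anticommute. -/
theorem sgn_rev (i : Fin (2 * n)) : sgn i.rev = -sgn i := by
  unfold sgn
  rw [Fin.val_rev]
  split_ifs <;> first | omega | norm_num

/-- The quaternionic structure: on the horizontal part `ℝ^{4n}` it is the action of `SU(2)`
on `ℂ²ⁿ`, which commutes with `rot`, and on the span of the center and `ℝ³` it is the left
multiplication of quaternions. -/
def quatFun : Fin 3 → NilVec n → NilVec n
  | 0, v => ((fun i => -(sgn i * v.1.2.1 i), fun i => sgn i * v.1.1 i, -v.2 0),
      ![v.1.2.2, -v.2 2, v.2 1])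
  | 1, v => ((fun i => sgn i * v.1.1 i.rev, fun i => sgn i * v.1.2.1 i.rev, -v.2 1),
      ![v.2 2, v.1.2.2, -v.2 0])
  | 2, v => ((fun i => -v.1.2.1 i.rev, fun i => v.1.1 i.rev, -v.2 2),
      ![-v.2 1, v.2 0, v.1.2.2])

/-- `quatFun` as a continuous linear map. -/
def quat (a : Fin 3) : NilVec n →L[ℝ] NilVec n :=
  LinearMap.toContinuousLinearMap
    { toFun := quatFun a
      map_add' := by
        intro v w
        fin_cases a <;>
        · refine Prod.ext (Prod.ext ?_ (Prod.ext ?_ ?_)) ?_ <;>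
            first
            | (funext i; simp [quatFun]; done)
            | (funext i; simp [quatFun]; ring1)
            | (simp [quatFun]; done)
            | (simp [quatFun]; ring1)
      map_smul' := by
        intro c v
        fin_cases a <;>
        · refine Prod.ext (Prod.ext ?_ (Prod.ext ?_ ?_)) ?_ <;>
            first
            | (funext i; simp [quatFun]; done)
            | (funext i; simp [quatFun]; ring1)
            | simp [quatFun] }

theorem quat_apply (a : Fin 3) (v : NilVec n) : quat a v = quatFun a v := rfl

theorem quat_mul (v : NilVec n) : quat 0 (quat 1 v) = quat 2 v := by
  simp only [quat_apply]
  refine Prod.ext (Prod.ext ?_ (Prod.ext ?_ ?_)) ?_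
  · funext i; simp [quatFun, ← mul_assoc, sgn_mul_self]
  · funext i; simp [quatFun, ← mul_assoc, sgn_mul_self]
  · simp [quatFun]
  · ext i; fin_cases i <;> simp [quatFun]

theorem quat_mul_swap (v : NilVec n) : quat 1 (quat 0 v) = -quat 2 v := by
  simp only [quat_apply]
  refine Prod.ext (Prod.ext ?_ (Prod.ext ?_ ?_)) ?_
  · funext i; simp [quatFun, ← mul_assoc, sgn_mul_self, sgn_rev]
  · funext i; simp [quatFun, ← mul_assoc, sgn_mul_self, sgn_rev]
  · simp [quatFun]
  · ext i; fin_cases i <;> simp [quatFun]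

theorem quat_sq (a : Fin 3) (v : NilVec n) : quat a (quat a v) = -v := by
  simp only [quat_apply]
  fin_cases a <;>
  · refine Prod.ext (Prod.ext ?_ (Prod.ext ?_ ?_)) ?_
    · funext i; simp [quatFun, ← mul_assoc, sgn_mul_self, sgn_rev]
    · funext i; simp [quatFun, ← mul_assoc, sgn_mul_self, sgn_rev]
    · simp [quatFun]
    · ext i; fin_cases i <;> simp [quatFun]

/-- In the horizontal coordinates `x + i y`, `rot` is multiplication by `i`, while the three
structures are `i · sgn`, `sgn · rev` and `i · rev`, all complex linear. On the remaining four
coordinates `rot` vanishes. -/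
theorem rot_quat (a : Fin 3) (v : NilVec n) : rot (quat a v) = quat a (rot v) := by
  simp only [quat_apply, rot_apply]
  fin_cases a <;>
  · refine Prod.ext (Prod.ext ?_ (Prod.ext ?_ ?_)) ?_
    · funext i; simp [quatFun]
    · funext i; simp [quatFun]
    · simp [quatFun]
    · ext i; fin_cases i <;> simp [quatFun]

theorem sum_rev (f : Fin (2 * n) → ℝ) : ∑ i : Fin (2 * n), f i.rev = ∑ i, f i :=
  Equiv.sum_comp Fin.revPerm f

/-- Source of the Abelian condition, since the bracket is `ω` times `Z`. Conceptually, `ω(v, w) = ⟨J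
v, w⟩` and `quat a` is orthogonal and commutes with `J`; the proof checks coordinates. -/
theorem omega_quat (a : Fin 3) (v w : NilVec n) : omega (quat a v) (quat a w) = omega v w := by
  have key (i : Fin (2 * n)) (p q : ℝ) : sgn i * p * (sgn i * q) = p * q := by
    rw [mul_mul_mul_comm, sgn_mul_self, one_mul]
  simp only [omega_apply, quat_apply]
  match a with
  | 0 =>
    refine Finset.sum_congr rfl fun i _ => ?_
    simp only [quatFun, neg_mul, mul_neg, key]
    ring
  | 1 =>
    -- `quat 1` and `quat 2` put coordinate `i.rev` in slot `i`, so the sums match only after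
    -- reindexing.
    rw [← sum_rev]
    refine Finset.sum_congr rfl fun i _ => ?_
    simp only [quatFun, key, Fin.rev_rev]
  | 2 =>
    rw [← sum_rev]
    refine Finset.sum_congr rfl fun i _ => ?_
    simp only [quatFun, Fin.rev_rev]
    ring

theorem inner₀_quat (a : Fin 3) (v w : NilVec n) : inner₀ (quat a v) (quat a w) = inner₀ v w := by
  have key (i : Fin (2 * n)) (p q : ℝ) : sgn i * p * (sgn i * q) = p * q := by
    rw [mul_mul_mul_comm, sgn_mul_self, one_mul]
  simp only [inner₀_apply, quat_apply]
  match a with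
  | 0 =>
    congr 1
    · refine Finset.sum_congr rfl fun i _ => ?_
      simp only [quatFun, neg_mul_neg, key]
      ring
    · simp [quatFun, Fin.sum_univ_three]; ring
  | 1 =>
    congr 1
    · rw [← sum_rev]
      refine Finset.sum_congr rfl fun i _ => ?_
      simp only [quatFun, key, Fin.rev_rev]
    · simp [quatFun, Fin.sum_univ_three]; ring
  | 2 =>
    congr 1
    · rw [← sum_rev]
      refine Finset.sum_congr rfl fun i _ => ?_
      simp only [quatFun, Fin.rev_rev]
      ring
    · simp [quatFun, Fin.sum_univ_three]; ring

theorem inner₀_rot (v w : NilVec n) : inner₀ (rot v) w = omega v w := by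
  simp only [omega_apply, inner₀_apply, rot_apply]
  simp [neg_add_eq_sub]

theorem inner₀_center (v : NilVec n) : inner₀ v center = theta v := by
  simp [inner₀_apply, center, theta_apply]

theorem inner₀_comm (v w : NilVec n) : inner₀ v w = inner₀ w v := by
  simp [inner₀_apply, mul_comm]

theorem omega_swap (v w : NilVec n) : omega v w = -omega w v := by
  simp only [omega_apply, ← Finset.sum_neg_distrib]
  exact Finset.sum_congr rfl fun i _ => by ring

theorem omega_center (v : NilVec n) : omega v center = 0 := by
  simp [omega_apply, center]

theorem omega_center_left (v : NilVec n) : omega center v = 0 := by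
  simp [omega_apply, center]

theorem inner₀_pos (v : NilVec n) (hv : v ≠ 0) : 0 < inner₀ v v := by
  have h1 : 0 ≤ ∑ i, (v.1.1 i * v.1.1 i + v.1.2.1 i * v.1.2.1 i) :=
    Finset.sum_nonneg fun i _ => add_nonneg (mul_self_nonneg _) (mul_self_nonneg _)
  have h2 : 0 ≤ ∑ j, v.2 j * v.2 j := Finset.sum_nonneg fun i _ => mul_self_nonneg _
  have h3 := mul_self_nonneg v.1.2.2
  refine lt_of_le_of_ne (by rw [inner₀_apply]; positivity) fun h => hv ?_
  rw [inner₀_apply] at h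
  have e1 : ∑ i, (v.1.1 i * v.1.1 i + v.1.2.1 i * v.1.2.1 i) = 0 := by linarith
  have e2 : ∑ j, v.2 j * v.2 j = 0 := by linarith
  have e3 : v.1.2.2 * v.1.2.2 = 0 := by linarith
  rw [Finset.sum_eq_zero_iff_of_nonneg
    fun i _ => add_nonneg (mul_self_nonneg _) (mul_self_nonneg _)] at e1
  rw [Finset.sum_eq_zero_iff_of_nonneg fun i _ => mul_self_nonneg _] at e2
  refine Prod.ext (Prod.ext ?_ (Prod.ext ?_ ?_)) ?_
  · funext i
    have := e1 i (Finset.mem_univ i)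
    show v.1.1 i = 0
    nlinarith [mul_self_nonneg (v.1.1 i), mul_self_nonneg (v.1.2.1 i)]
  · funext i
    have := e1 i (Finset.mem_univ i)
    show v.1.2.1 i = 0
    nlinarith [mul_self_nonneg (v.1.1 i), mul_self_nonneg (v.1.2.1 i)]
  · simpa using e3
  · funext i
    simpa using e2 i (Finset.mem_univ i)

/-- Invariance of `ω` together with `I² = -1` makes `ω(·, I ·)` symmetric. It is therefore the polar
form of the quadratic form `ω(u, I u)` used in `holCoord`. -/
theorem omega_quat_comm (a : Fin 3) (v w : NilVec n) :
    omega v (quat a w) = omega w (quat a v) := by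
  rw [← omega_quat a v, quat_sq, map_neg, omega_swap, neg_neg]

theorem omega_quat_center (a : Fin 3) (v : NilVec n) : omega v (quat a center) = 0 := by
  rw [omega_quat_comm, omega_center_left]

/-! ### Left translations, the Maurer-Cartan form and holomorphic coordinates on `N`. -/

/-- Left multiplication in `N`. -/
def lmul (u w : NilVec n) : NilVec n := u + w + (omega u w / 2) • center

/-- The Maurer-Cartan form of `N` at the point `u`, in exponential coordinates. -/
def maurerCartan (u : NilVec n) : NilVec n ≃L[ℝ] NilVec n :=
  ContinuousLinearEquiv.equivOfInverse
    (ContinuousLinearMap.id ℝ _ - (1 / 2 : ℝ) • (omega u).smulRight center)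
    (ContinuousLinearMap.id ℝ _ + (1 / 2 : ℝ) • (omega u).smulRight center)
    (by intro w; simp [omega_center]) (by intro w; simp [omega_center])

theorem maurerCartan_apply (u w : NilVec n) :
    maurerCartan u w = w - (1 / 2 : ℝ) • omega u w • center := rfl

theorem maurerCartan_symm_apply (u w : NilVec n) :
    (maurerCartan u).symm w = w + (1 / 2 : ℝ) • omega u w • center := rfl

theorem contDiff_maurerCartan :
    ContDiff ℝ ∞ (fun u : NilVec n => (maurerCartan u : NilVec n →L[ℝ] NilVec n)) := by
  have : (fun u : NilVec n => (maurerCartan u : NilVec n →L[ℝ] NilVec n)) = fun u =>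
    (ContinuousLinearMap.id ℝ _ - (1 / 2 : ℝ) • (omega u).smulRight center) := rfl
  rw [this]
  have h : ContDiff ℝ ∞ fun u : NilVec n => (omega u).smulRight (center (n := n)) :=
    (((ContinuousLinearMap.smulRightL ℝ (NilVec n) (NilVec n)).flip center).comp omega).contDiff
  exact contDiff_const.sub (h.const_smul _)

theorem contDiff_maurerCartan_symm :
    ContDiff ℝ ∞ (fun u : NilVec n => ((maurerCartan u).symm : NilVec n →L[ℝ] NilVec n)) := by
  have : (fun u : NilVec n => ((maurerCartan u).symm : NilVec n →L[ℝ] NilVec n)) = fun u =>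
    (ContinuousLinearMap.id ℝ _ + (1 / 2 : ℝ) • (omega u).smulRight center) := rfl
  rw [this]
  have h : ContDiff ℝ ∞ fun u : NilVec n => (omega u).smulRight (center (n := n)) :=
    (((ContinuousLinearMap.smulRightL ℝ (NilVec n) (NilVec n)).flip center).comp omega).contDiff
  exact contDiff_const.add (h.const_smul _)

theorem hasFDerivAt_lmul (u w : NilVec n) :
    HasFDerivAt (lmul u)
      (ContinuousLinearMap.id ℝ (NilVec n) + (1 / 2 : ℝ) • (omega u).smulRight center) w := by
  have h : lmul u = fun w : NilVec n => u +
      (ContinuousLinearMap.id ℝ (NilVec n) + (1 / 2 : ℝ) • (omega u).smulRight center :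
        NilVec n →L[ℝ] NilVec n) w := by
    funext w
    simp only [lmul, _root_.add_apply, _root_.smul_apply,
      ContinuousLinearMap.smulRight_apply, ContinuousLinearMap.id_apply]
    module
  rw [h]
  exact (ContinuousLinearMap.hasFDerivAt _).const_add u

theorem contDiff_lmul (u : NilVec n) : ContDiff ℝ ∞ (lmul u) := by
  unfold lmul
  fun_prop

/-- Left invariance of the Maurer-Cartan form: the argument on the left is the image of `v` under
the derivative of `lmul u`, which is the same at every point. -/
theorem maurerCartan_lmul (u w v : NilVec n) :
    maurerCartan (lmul u w) (v + (1 / 2 : ℝ) • omega u v • center) = maurerCartan w v := by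
  simp only [maurerCartan_apply, lmul, map_add, map_smul, _root_.add_apply,
    _root_.smul_apply, omega_center, omega_center_left, smul_eq_mul]
  module

/-- Coordinates carrying the left-invariant complex structure given by `quat a` to a constant
one. -/
def holCoord (a : Fin 3) (u : NilVec n) : NilVec n :=
  u - (omega u (quat a u) / 4) • quat a center

theorem contDiff_holCoord (a : Fin 3) : ContDiff ℝ ∞ (holCoord (n := n) a) := by
  unfold holCoord
  fun_prop

/-- `holCoord` as a homeomorphism. -/
def holCoordHomeomorph (a : Fin 3) : NilVec n ≃ₜ NilVec n where
  toFun := holCoord a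
  invFun := fun u => u + (omega u (quat a u) / 4) • quat a center
  -- The value `ω(u, I u)` is unchanged when a multiple of `I Z` is added to `u`, because `Z` and `I
  -- Z` lie in the radical of `ω`. Hence the opposite shear is the inverse.
  left_inv := fun u => by
    simp [holCoord, omega_quat_center, omega_swap (quat a center), quat_sq, omega_center]
  right_inv := fun u => by
    simp [holCoord, omega_quat_center, omega_swap (quat a center), quat_sq, omega_center]
  continuous_toFun := (contDiff_holCoord a).continuous
  continuous_invFun := by fun_prop

theorem contDiff_holCoordHomeomorph_symm (a : Fin 3) :
    ContDiff ℝ ∞ ((holCoordHomeomorph (n := n) a).symm) := by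
  change ContDiff ℝ ∞ fun u : NilVec n => u + (omega u (quat a u) / 4) • quat a center
  fun_prop

theorem hasFDerivAt_holCoord (a : Fin 3) (u : NilVec n) :
    HasFDerivAt (holCoord a)
      (ContinuousLinearMap.id ℝ _ -
        (1 / 2 : ℝ) • ((omega u).comp (quat a)).smulRight (quat a center)) u := by
  have h1 : HasFDerivAt (fun w : NilVec n => omega w (quat a w))
      ((omega.precompR (NilVec n) u (quat a)) + omega.precompL (NilVec n)
        (ContinuousLinearMap.id ℝ _) (quat a u)) u :=
    omega.hasFDerivAt_of_bilinear (hasFDerivAt_id u) (quat a).hasFDerivAt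
  have h2 := (hasFDerivAt_id u).sub
    (((h1.const_smul (1 / 4 : ℝ))).smul_const (quat a (center (n := n))))
  refine (h2.congr_fderiv ?_).congr_of_eventuallyEq (Filter.Eventually.of_forall fun w => ?_)
  · refine ContinuousLinearMap.ext fun w => ?_
    simp only [_root_.sub_apply, _root_.smul_apply,
      ContinuousLinearMap.smulRight_apply, ContinuousLinearMap.id_apply,
      _root_.add_apply, ContinuousLinearMap.precompR_apply,
      ContinuousLinearMap.precompL_apply, ContinuousLinearMap.comp_apply, smul_eq_mul]
    -- By symmetry of `ω(·, I ·)` the two product-rule terms coincide, turning `1/4` into `1/2`.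
    rw [show (ContinuousLinearMap.compL ℝ (NilVec n) (NilVec n) ℝ (omega u)) (quat a) w =
      omega u (quat a w) from rfl, omega_quat_comm a w u]
    module
  · simp only [holCoord, Pi.sub_apply, id, Pi.smul_apply, smul_eq_mul]
    module

/-- In the left-invariant frame the derivative of the shear is `w ↦ w + (ω(u, w) Z - ω(u, I w) I Z)
/ 2`. The shear adds exactly the second term, which makes the correction commute with `I`. -/
theorem fderiv_holCoord_intertwines (a : Fin 3) (u v : NilVec n) :
    fderiv ℝ (holCoord a) u ((maurerCartan u).symm (quat a (maurerCartan u v))) =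
      quat a (fderiv ℝ (holCoord a) u v) := by
  rw [(hasFDerivAt_holCoord a u).fderiv]
  obtain ⟨w, rfl⟩ := (maurerCartan u).symm.surjective v
  rw [ContinuousLinearEquiv.apply_symm_apply]
  simp only [maurerCartan_symm_apply, _root_.sub_apply,
    _root_.smul_apply, ContinuousLinearMap.smulRight_apply,
    ContinuousLinearMap.id_apply, ContinuousLinearMap.comp_apply, map_add, map_sub, map_smul,
    quat_sq, map_neg, omega_quat_center]
  module

/-- The left-invariant vector fields on `N` satisfy `[v, w] = ω(v, w) Z`. -/
theorem lieBracket_maurerCartan_symm (v w u : NilVec n) :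
    VectorField.lieBracket ℝ (fun u => (maurerCartan u).symm v)
      (fun u => (maurerCartan u).symm w) u = omega v w • center := by
  have h (w u : NilVec n) : HasFDerivAt (fun u => (maurerCartan u).symm w)
      ((1 / 2 : ℝ) • (omega.flip w).smulRight center) u := by
    have : (fun u => (maurerCartan u).symm w) = fun u : NilVec n => w +
        ((1 / 2 : ℝ) • (omega.flip w).smulRight center) u := rfl
    rw [this]
    exact (ContinuousLinearMap.hasFDerivAt _).const_add w
  rw [VectorField.lieBracket, (h w u).fderiv, (h v u).fderiv]
  simp only [maurerCartan_symm_apply, _root_.smul_apply,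
    ContinuousLinearMap.smulRight_apply, ContinuousLinearMap.flip_apply, map_add, map_smul,
    omega_center_left, omega_swap w v]
  module

/-- `c(u, v, w) = ⟨u, T(v, w)⟩` is skew-symmetric, where
`T(v, w) = -θ(v) J w + θ(w) J v - [v, w]`. -/
theorem inner₀_torsion (u v w : NilVec n) :
    inner₀ u (-(theta v • rot w) + theta w • rot v - omega v w • center) =
      -(theta v * omega w u + theta w * omega u v + theta u * omega v w) := by
  simp only [map_sub, map_add, map_neg, map_smul, smul_eq_mul, inner₀_center,
    inner₀_comm u (rot _), inner₀_rot]
  rw [omega_swap v u]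
  ring

end NilVec

end HKT

end

noncomputable section

namespace HKT

open NilVec Filter
open scoped Topology

/-! ### Manifolds locally modelled on `N` with its left translations -/

/-- The charts of `M` differ by left translations of `N`. -/
class IsNilStructure (n : ℕ) (M : Type) [TopologicalSpace M] [ChartedSpace (NilVec n) M] :
    Prop where
  exists_lmul : ∀ e ∈ atlas (NilVec n) M, ∀ e' ∈ atlas (NilVec n) M, ∀ x ∈ e.source,
    x ∈ e'.source → ∃ γ : NilVec n, e' =ᶠ[𝓝 x] fun y => lmul γ (e y)

section

variable {n : ℕ} {M : Type} [TopologicalSpace M] [ChartedSpace (NilVec n) M]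

theorem IsNilStructure.isManifold [hM : IsNilStructure n M] : IsManifold 𝓘(ℝ, NilVec n) ∞ M := by
  refine isManifold_of_contDiffOn _ _ _ fun e e' he he' u hu => ?_
  simp only [modelWithCornersSelf_coe_symm, Set.preimage_id_eq, id_eq, Set.mem_inter_iff,
    OpenPartialHomeomorph.trans_source, OpenPartialHomeomorph.symm_source,
    Set.mem_preimage] at hu
  obtain ⟨⟨hu, hu'⟩, -⟩ := hu
  obtain ⟨γ, hγ⟩ := hM.exists_lmul e he e' he' _ (e.map_target hu) hu'
  refine ContDiffAt.contDiffWithinAt ((contDiff_lmul γ).contDiffAt.congr_of_eventuallyEq ?_)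
  have h1 : ∀ᶠ w in 𝓝 u, e' (e.symm w) = lmul γ (e (e.symm w)) :=
    (e.symm.continuousAt hu).eventually hγ
  filter_upwards [h1, e.open_target.mem_nhds hu] with w hw hwt
  simpa [e.right_inv hwt] using hw

variable (n) in
/-- The Maurer-Cartan parallelism of `M`, written in the preferred chart at the point. -/
def coframe (x : M) : Tan (NilVec n) M x ≃L[ℝ] NilVec n :=
  maurerCartan (chartAt (NilVec n) x x)

theorem eventually_mem_chart_source (p : M) : ∀ᶠ x in 𝓝 p, x ∈ (chartAt (NilVec n) p).source :=
  (chartAt (NilVec n) p).open_source.mem_nhds (mem_chart_source _ p)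

variable [IsManifold 𝓘(ℝ, NilVec n) ∞ M]

theorem contMDiffAt_chart (p : M) :
    ContMDiffAt 𝓘(ℝ, NilVec n) 𝓘(ℝ, NilVec n) ∞ (chartAt (NilVec n) p) p :=
  contMDiffAt_of_mem_maximalAtlas (IsManifold.chart_mem_maximalAtlas p) (mem_chart_source _ p)

theorem contMDiffAt_maurerCartan_chart (p : M) :
    ContMDiffAt 𝓘(ℝ, NilVec n) 𝓘(ℝ, NilVec n →L[ℝ] NilVec n) ∞
      (fun x => (maurerCartan (chartAt (NilVec n) p x) : NilVec n →L[ℝ] NilVec n)) p :=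
  (contDiff_maurerCartan.contMDiff.contMDiffAt).comp p (contMDiffAt_chart p)

theorem contMDiffAt_maurerCartan_symm_chart (p : M) :
    ContMDiffAt 𝓘(ℝ, NilVec n) 𝓘(ℝ, NilVec n →L[ℝ] NilVec n) ∞
      (fun x => ((maurerCartan (chartAt (NilVec n) p x)).symm : NilVec n →L[ℝ] NilVec n)) p :=
  (contDiff_maurerCartan_symm.contMDiff.contMDiffAt).comp p (contMDiffAt_chart p)

theorem mfderiv_chartAt_self (x : M) (v : Tan (NilVec n) M x) :
    mfderiv 𝓘(ℝ, NilVec n) 𝓘(ℝ, NilVec n) (chartAt (NilVec n) x) x v = v := by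
  rw [mfderiv_chartAt_eq_tangentCoordChange (mem_chart_source _ x)]
  exact tangentCoordChange_self (I := 𝓘(ℝ, NilVec n)) (mem_extChartAt_source x)

variable [hM : IsNilStructure n M]

/-- The definition of `coframe` uses a chart that changes with the point. Any other atlas chart
differs from it near `x` by a left translation, under which the Maurer-Cartan form is invariant.
Fixing one chart near a point thus gives smoothness. -/
theorem coframe_eq {e : OpenPartialHomeomorph M (NilVec n)} (he : e ∈ atlas (NilVec n) M) {x : M}
    (hx : x ∈ e.source) (v : Tan (NilVec n) M x) :
    coframe n x v = maurerCartan (e x) (mfderiv 𝓘(ℝ, NilVec n) 𝓘(ℝ, NilVec n) e x v) := by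
  obtain ⟨γ, hγ⟩ := hM.exists_lmul _ (chart_mem_atlas (NilVec n) x) e he x
    (mem_chart_source _ x) hx
  have h1 := (hasFDerivAt_lmul γ (chartAt (NilVec n) x x)).hasMFDerivAt
  have h2 := (mdifferentiableAt_atlas (I := 𝓘(ℝ, NilVec n)) (chart_mem_atlas (NilVec n) x)
    (mem_chart_source _ x)).hasMFDerivAt
  have h3 := (h1.comp x h2).congr_of_eventuallyEq hγ
  rw [h3.mfderiv, hγ.self_of_nhds]
  refine ((maurerCartan_lmul γ _ _).symm.trans ?_)
  congr 1
  refine Eq.trans ?_ (congrArg (ContinuousLinearMap.id ℝ (NilVec n) +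
    (1 / 2 : ℝ) • (omega γ).smulRight center : NilVec n →L[ℝ] NilVec n)
    (mfderiv_chartAt_self x v)).symm
  rfl

theorem coframe_eq_trivializationAt {p x : M} (hx : x ∈ (chartAt (NilVec n) p).source)
    (v : Tan (NilVec n) M x) :
    coframe n x v = maurerCartan (chartAt (NilVec n) p x)
      (trivializationAt (NilVec n) (Tan (NilVec n) M) p ⟨x, v⟩).2 := by
  rw [coframe_eq (chart_mem_atlas _ p) hx,
    mfderiv_chartAt_eq_tangentCoordChange hx]
  rfl

theorem trivializationAt_coframe_symm {p x : M} (hx : x ∈ (chartAt (NilVec n) p).source)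
    (w : NilVec n) :
    (trivializationAt (NilVec n) (Tan (NilVec n) M) p ⟨x, (coframe n x).symm w⟩).2 =
      (maurerCartan (chartAt (NilVec n) p x)).symm w := by
  rw [ContinuousLinearEquiv.eq_symm_apply, ← coframe_eq_trivializationAt hx,
    ContinuousLinearEquiv.apply_symm_apply]

theorem coframe_symmL {p x : M} (hx : x ∈ (chartAt (NilVec n) p).source) (w : NilVec n) :
    coframe n x ((trivializationAt (NilVec n) (Tan (NilVec n) M) p).symmL ℝ x w) =
      maurerCartan (chartAt (NilVec n) p x) w := by
  rw [coframe_eq_trivializationAt hx]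
  congr 1
  have := (trivializationAt (NilVec n) (Tan (NilVec n) M) p).continuousLinearMapAt_symmL (R := ℝ)
    (b := x) hx w
  rwa [Trivialization.continuousLinearMapAt_apply,
    Trivialization.linearMapAt_apply,
    if_pos (show x ∈ (trivializationAt (NilVec n) (Tan (NilVec n) M) p).baseSet from hx)] at this

theorem contMDiffAt_coframe_symmL (p : M) :
    ContMDiffAt 𝓘(ℝ, NilVec n) 𝓘(ℝ, NilVec n →L[ℝ] NilVec n) ∞
      (fun x => (coframe n x : Tan (NilVec n) M x →L[ℝ] NilVec n).comp
        ((trivializationAt (NilVec n) (Tan (NilVec n) M) p).symmL ℝ x)) p := by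
  refine (contMDiffAt_maurerCartan_chart (n := n) p).congr_of_eventuallyEq ?_
  filter_upwards [eventually_mem_chart_source (n := n) p] with x hx
  exact ContinuousLinearMap.ext fun w => coframe_symmL hx w

theorem contMDiffAt_coframe_apply {Y : (x : M) → Tan (NilVec n) M x} {p : M}
    {k : WithTop ℕ∞} (hk : k ≤ ∞)
    (hY : ContMDiffAt 𝓘(ℝ, NilVec n) 𝓘(ℝ, NilVec n).tangent k
      (fun x => TotalSpace.mk' (NilVec n) (E := Tan (NilVec n) M) x (Y x)) p) :
    ContMDiffAt 𝓘(ℝ, NilVec n) 𝓘(ℝ, NilVec n) k (fun x => coframe n x (Y x)) p := by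
  have h := (contMDiffAt_section p).1 hY
  refine (((contMDiffAt_maurerCartan_chart (n := n) p).of_le hk).clm_apply h).congr_of_eventuallyEq ?_
  filter_upwards [eventually_mem_chart_source (n := n) p] with x hx
  exact coframe_eq_trivializationAt hx _

theorem mdifferentiableAt_coframe_apply {Y : (x : M) → Tan (NilVec n) M x} {p : M}
    (hY : DiffAt Y p) :
    MDifferentiableAt 𝓘(ℝ, NilVec n) 𝓘(ℝ, NilVec n) (fun x => coframe n x (Y x)) p := by
  have h := (mdifferentiableAt_section _ _).1 hY
  refine (((contMDiffAt_maurerCartan_chart (n := n) p).mdifferentiableAt (by simp)).clm_apply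
    h).congr_of_eventuallyEq ?_
  filter_upwards [eventually_mem_chart_source (n := n) p] with x hx
  exact coframe_eq_trivializationAt hx _

theorem diffAt_coframe_symm (w : NilVec n) (p : M) :
    DiffAt (fun x : M => (coframe n x).symm w) p := by
  refine (mdifferentiableAt_section _ _).2 ?_
  refine (((contMDiffAt_maurerCartan_symm_chart (n := n) p).mdifferentiableAt (by simp)).clm_apply
    (mdifferentiableAt_const (c := w))).congr_of_eventuallyEq ?_
  filter_upwards [eventually_mem_chart_source (n := n) p] with x hx
  exact trivializationAt_coframe_symm hx _

/-- Reduces smoothness of an endomorphism field to that of its values in the coframe; it serves both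
the complex structures and the covariant derivative. -/
theorem contMDiffAt_coframe_symm_comp {φ : (x : M) → Tan (NilVec n) M x →L[ℝ] NilVec n} {p : M}
    (hφ : ContMDiffAt 𝓘(ℝ, NilVec n) 𝓘(ℝ, NilVec n →L[ℝ] NilVec n) ∞
      (fun x => (φ x).comp ((trivializationAt (NilVec n) (Tan (NilVec n) M) p).symmL ℝ x)) p) :
    ContMDiffAt 𝓘(ℝ, NilVec n) (𝓘(ℝ, NilVec n).prod 𝓘(ℝ, NilVec n →L[ℝ] NilVec n)) ∞
      (fun x => TotalSpace.mk' (NilVec n →L[ℝ] NilVec n)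
        (E := fun x : M => Tan (NilVec n) M x →L[ℝ] Tan (NilVec n) M x) x
        (((coframe n x).symm : NilVec n →L[ℝ] Tan (NilVec n) M x).comp (φ x))) p := by
  refine (contMDiffAt_hom_bundle _).2 ⟨contMDiffAt_id, ?_⟩
  refine ((contMDiffAt_maurerCartan_symm_chart (n := n) p).clm_comp hφ).congr_of_eventuallyEq ?_
  filter_upwards [eventually_mem_chart_source (n := n) p] with x hx
  refine ContinuousLinearMap.ext fun w => ?_
  have h := trivializationAt_coframe_symm hx (φ x
    ((trivializationAt (NilVec n) (Tan (NilVec n) M) p).symmL ℝ x w))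
  simp only [ContinuousLinearMap.inCoordinates, ContinuousLinearMap.comp_apply,
    ContinuousLinearEquiv.coe_coe]
  rw [Trivialization.continuousLinearMapAt_apply, Trivialization.linearMapAt_apply,
    if_pos (show x ∈ (trivializationAt (NilVec n) (Tan (NilVec n) M) p).baseSet from hx)]
  exact h

end

end HKT

end

/-! ### The hyper-Hermitian structure on a manifold modelled on `N`. -/

noncomputable section

namespace HKT

open NilVec Filter
open scoped Topology

/-- The norm on `NilVec n` is a maximum of coordinates, bounded by the Euclidean norm. This gives
the boundedness of unit balls demanded of a Riemannian metric. -/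
theorem NilVec.norm_le_one_of_inner₀_lt {n : ℕ} {v : NilVec n} (hv : inner₀ v v < 1) :
    ‖v‖ ≤ 1 := by
  have s1 (i) : 0 ≤ v.1.1 i * v.1.1 i + v.1.2.1 i * v.1.2.1 i :=
    add_nonneg (mul_self_nonneg _) (mul_self_nonneg _)
  have h1 : 0 ≤ ∑ i, (v.1.1 i * v.1.1 i + v.1.2.1 i * v.1.2.1 i) :=
    Finset.sum_nonneg fun i _ => s1 i
  have h2 : 0 ≤ ∑ j, v.2 j * v.2 j := Finset.sum_nonneg fun i _ => mul_self_nonneg _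
  have h3 := mul_self_nonneg v.1.2.2
  rw [inner₀_apply] at hv
  have key {r : ℝ} (hr : r * r < 1) : ‖r‖ ≤ 1 := by
    rw [Real.norm_eq_abs, abs_le_one_iff_mul_self_le_one]
    exact hr.le
  have hs1 (i) := Finset.single_le_sum (f := fun i => v.1.1 i * v.1.1 i + v.1.2.1 i * v.1.2.1 i)
    (fun i _ => s1 i) (Finset.mem_univ i)
  have hs2 (j) := Finset.single_le_sum (f := fun j => v.2 j * v.2 j)
    (fun j _ => mul_self_nonneg _) (Finset.mem_univ j)
  refine max_le (max_le ?_ (max_le ?_ ?_)) ?_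
  · refine (pi_norm_le_iff_of_nonneg zero_le_one).2 fun i => key ?_
    linarith [hs1 i, mul_self_nonneg (v.1.2.1 i)]
  · refine (pi_norm_le_iff_of_nonneg zero_le_one).2 fun i => key ?_
    linarith [hs1 i, mul_self_nonneg (v.1.1 i)]
  · exact key (by linarith)
  · refine (pi_norm_le_iff_of_nonneg zero_le_one).2 fun j => key ?_
    linarith [hs2 j]

/-- The pullback of `inner₀` by an endomorphism. -/
def NilVec.pullbackInner₀ {n : ℕ} (L : NilVec n →L[ℝ] NilVec n) :
    NilVec n →L[ℝ] NilVec n →L[ℝ] ℝ :=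
  ((ContinuousLinearMap.compL ℝ (NilVec n) (NilVec n) ℝ).flip L).comp (inner₀.comp L)

theorem NilVec.contDiff_pullbackInner₀ {n : ℕ} : ContDiff ℝ ∞ (pullbackInner₀ (n := n)) := by
  have h1 : ContDiff ℝ ∞ (ContinuousLinearMap.compL ℝ (NilVec n) (NilVec n) ℝ).flip :=
    ContinuousLinearMap.contDiff _
  have h2 : ContDiff ℝ ∞ fun _ : NilVec n →L[ℝ] NilVec n => inner₀ (n := n) := contDiff_const
  exact h1.clm_comp (h2.clm_comp contDiff_id)

section

variable {n : ℕ} {M : Type} [TopologicalSpace M] [ChartedSpace (NilVec n) M]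

variable (n M) in
/-- The left-invariant endomorphism field with value `quat a`. -/
def quatField (a : Fin 3) : EndoField (NilVec n) M := fun x =>
  ((coframe n x).symm : NilVec n →L[ℝ] Tan (NilVec n) M x).comp
    ((quat a).comp (coframe n x : Tan (NilVec n) M x →L[ℝ] NilVec n))

theorem coframe_quatField (a : Fin 3) (x : M) (v : Tan (NilVec n) M x) :
    coframe n x (quatField n M a x v) = quat a (coframe n x v) :=
  (coframe n x).apply_symm_apply _

theorem quatField_sq (a : Fin 3) (x : M) (v : Tan (NilVec n) M x) :
    quatField n M a x (quatField n M a x v) = -v :=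
  (coframe n x).injective (by simp [coframe_quatField, quat_sq])

variable (n M) in
/-- The left-invariant bilinear form with value `inner₀`. -/
def metricForm (x : M) : Tan (NilVec n) M x →L[ℝ] Tan (NilVec n) M x →L[ℝ] ℝ :=
  pullbackInner₀ (maurerCartan (chartAt (NilVec n) x x) : NilVec n →L[ℝ] NilVec n)

theorem metricForm_apply (x : M) (v w : Tan (NilVec n) M x) :
    metricForm n M x v w = inner₀ (coframe n x v) (coframe n x w) := rfl

theorem isVonNBounded_metricForm (x : M) :
    Bornology.IsVonNBounded ℝ {v : Tan (NilVec n) M x | metricForm n M x v v < 1} := by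
  have h : Bornology.IsVonNBounded ℝ {v : NilVec n | inner₀ v v < 1} :=
    (NormedSpace.isVonNBounded_closedBall ℝ (NilVec n) 1).subset fun v hv => by
      simpa using norm_le_one_of_inner₀_lt hv
  refine (h.image ((coframe n x).symm : NilVec n →L[ℝ] Tan (NilVec n) M x)).subset
    fun v hv => (Set.mem_image _ _ _).2 ⟨coframe n x v, hv, (coframe n x).symm_apply_apply v⟩

variable [IsManifold 𝓘(ℝ, NilVec n) ∞ M]

/-- A chart of `M` followed by `holCoord`. -/
theorem trans_holCoord_mem_maximalAtlas (a : Fin 3) {e : OpenPartialHomeomorph M (NilVec n)}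
    (he : e ∈ atlas (NilVec n) M) :
    e.trans (holCoordHomeomorph a).toOpenPartialHomeomorph ∈
      IsManifold.maximalAtlas 𝓘(ℝ, NilVec n) ∞ M := by
  have hG : (holCoordHomeomorph (n := n) a).toOpenPartialHomeomorph ∈
      contDiffGroupoid ∞ 𝓘(ℝ, NilVec n) := by
    rw [contDiffGroupoid, mem_groupoid_of_pregroupoid]
    exact ⟨(contDiff_holCoord a).contDiffOn, (contDiff_holCoordHomeomorph_symm a).contDiffOn⟩
  have hG' := (contDiffGroupoid ∞ 𝓘(ℝ, NilVec n)).symm hG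
  intro e' he'
  have h1 := StructureGroupoid.compatible (contDiffGroupoid ∞ 𝓘(ℝ, NilVec n)) he he'
  have h2 := StructureGroupoid.compatible (contDiffGroupoid ∞ 𝓘(ℝ, NilVec n)) he' he
  constructor
  · rw [OpenPartialHomeomorph.trans_symm_eq_symm_trans_symm, OpenPartialHomeomorph.trans_assoc]
    exact StructureGroupoid.trans _ hG' h1
  · rw [← OpenPartialHomeomorph.trans_assoc]
    exact StructureGroupoid.trans _ h2 hG

variable [hM : IsNilStructure n M]

theorem contMDiff_metricForm :
    ContMDiff 𝓘(ℝ, NilVec n) (𝓘(ℝ, NilVec n).prod 𝓘(ℝ, NilVec n →L[ℝ] NilVec n →L[ℝ] ℝ)) ∞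
      (fun x => TotalSpace.mk' (NilVec n →L[ℝ] NilVec n →L[ℝ] ℝ)
        (E := fun x : M => Tan (NilVec n) M x →L[ℝ] Tan (NilVec n) M x →L[ℝ] ℝ) x
          (metricForm n M x)) := fun p => by
  refine (contMDiffAt_hom_bundle _).2 ⟨contMDiffAt_id, ?_⟩
  refine ((contDiff_pullbackInner₀ (n := n)).contMDiff.contMDiffAt.comp p
    (contMDiffAt_maurerCartan_chart (n := n) p)).congr_of_eventuallyEq ?_
  filter_upwards [eventually_mem_chart_source (n := n) p] with x hx
  refine ContinuousLinearMap.ext fun v => ContinuousLinearMap.ext fun w => ?_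
  have e1 := coframe_symmL hx v
  have e2 := coframe_symmL hx w
  rw [Trivialization.symmL_apply _ hx] at e1 e2
  refine (inCoordinates_apply_eq₂ hx hx (Set.mem_univ _)).trans ?_
  refine Eq.trans (b := metricForm n M x
    ((trivializationAt (NilVec n) (Tan (NilVec n) M) p).symm x v)
    ((trivializationAt (NilVec n) (Tan (NilVec n) M) p).symm x w)) (by simp) ?_
  rw [metricForm_apply, e1, e2]
  rfl

variable (n M) in
/-- The left-invariant metric with value `inner₀`. -/
def nilMetric : Metric (NilVec n) M where
  inner := metricForm n M
  symm _ _ _ := inner₀_comm _ _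
  pos x v hv := inner₀_pos (coframe n x v) ((map_ne_zero_iff _ (coframe n x).injective).2 hv)
  isVonNBounded := isVonNBounded_metricForm
  contMDiff := contMDiff_metricForm

theorem nilMetric_apply (x : M) (v w : Tan (NilVec n) M x) :
    (nilMetric n M).inner x v w = inner₀ (coframe n x v) (coframe n x w) := rfl

theorem contMDiff_quatField (a : Fin 3) :
    ContMDiff 𝓘(ℝ, NilVec n) (𝓘(ℝ, NilVec n).prod 𝓘(ℝ, NilVec n →L[ℝ] NilVec n)) ∞
      (fun x => TotalSpace.mk' (NilVec n →L[ℝ] NilVec n)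
        (E := fun x : M => Tan (NilVec n) M x →L[ℝ] Tan (NilVec n) M x) x
          (quatField n M a x)) := fun p =>
  contMDiffAt_coframe_symm_comp
    (ContMDiffAt.clm_comp (g := fun _ : M => quat (n := n) a) contMDiffAt_const
      (contMDiffAt_coframe_symmL (n := n) p))

theorem isComplexStructure_quatField (a : Fin 3) :
    IsComplexStructure (E := NilVec n) (quatField n M a) where
  smooth := contMDiff_quatField a
  sq := quatField_sq a
  integrable p := by
    have he := chart_mem_atlas (NilVec n) p
    refine ⟨_, trans_holCoord_mem_maximalAtlas a he, by simp, quat a, fun x hx v => ?_⟩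
    replace hx : x ∈ (chartAt (NilVec n) p).source := by simpa using hx
    have h1 := ((contDiff_holCoord a).differentiable (by simp)
      (chartAt (NilVec n) p x)).hasFDerivAt.hasMFDerivAt
    have h2 := (mdifferentiableAt_atlas (I := 𝓘(ℝ, NilVec n)) he hx).hasMFDerivAt
    have h3 : mfderiv 𝓘(ℝ, NilVec n) 𝓘(ℝ, NilVec n) ((chartAt (NilVec n) p).trans
        (holCoordHomeomorph a).toOpenPartialHomeomorph) x = _ := (h1.comp x h2).mfderiv
    rw [h3]
    have h4 := coframe_quatField a x v
    rw [coframe_eq he hx, coframe_eq he hx] at h4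
    refine Eq.trans ?_ (fderiv_holCoord_intertwines a (chartAt (NilVec n) p x)
      (mfderiv 𝓘(ℝ, NilVec n) 𝓘(ℝ, NilVec n) (chartAt (NilVec n) p) x v))
    exact congrArg (fderiv ℝ (holCoord a) (chartAt (NilVec n) p x))
      ((maurerCartan (chartAt (NilVec n) p x)).eq_symm_apply.2 h4)

theorem isHyperHermitian_quatField :
    IsHyperHermitian (E := NilVec n) (quatField n M) (nilMetric n M) where
  hypercomplex :=
    { complex := isComplexStructure_quatField
      mul := fun x v => (coframe n x).injective (by simp only [coframe_quatField, quat_mul])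
      mul_swap := fun x v => (coframe n x).injective (by
        simp only [coframe_quatField, quat_mul_swap, map_neg]) }
  hermitian a x v w := by
    simp only [nilMetric_apply, coframe_quatField, inner₀_quat]

/-! ### Brackets of the fields that are constant in the coframe. -/

theorem mlieBracket_eq_lieBracket {E : Type} [NormedAddCommGroup E] [NormedSpace ℝ E]
    (V W : (x : E) → TangentSpace 𝓘(ℝ, E) x) :
    VectorField.mlieBracket 𝓘(ℝ, E) V W = VectorField.lieBracket ℝ V W := by
  rw [← VectorField.mlieBracketWithin_univ, VectorField.mlieBracketWithin_eq_lieBracketWithin]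
  exact VectorField.lieBracketWithin_univ

theorem mlieBracket_maurerCartan_symm (v w u : NilVec n) :
    VectorField.mlieBracket 𝓘(ℝ, NilVec n) (M := NilVec n) (fun u => (maurerCartan u).symm v)
      (fun u => (maurerCartan u).symm w) u = omega v w • center :=
  (congrFun (mlieBracket_eq_lieBracket _ _) u).trans (lieBracket_maurerCartan_symm v w u)

theorem mlieBracket_coframe_symm (v w : NilVec n) (p : M) :
    VectorField.mlieBracket 𝓘(ℝ, NilVec n) (fun x : M => (coframe n x).symm v)
      (fun x : M => (coframe n x).symm w) p =
      (coframe n p).symm (omega v w • center) := by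
  have hM2 : IsManifold 𝓘(ℝ, NilVec n) (minSmoothness ℝ 2) M := by
    rw [minSmoothness_of_isRCLikeNormedField]; infer_instance
  set e := chartAt (NilVec n) p
  have he : e ∈ atlas (NilVec n) M := chart_mem_atlas (NilVec n) p
  have hV (v : NilVec n) (u : NilVec n) : MDifferentiableAt 𝓘(ℝ, NilVec n) 𝓘(ℝ, NilVec n).tangent
      (fun u => TotalSpace.mk' (NilVec n) (E := TangentSpace 𝓘(ℝ, NilVec n) (M := NilVec n)) u
        ((maurerCartan u).symm v)) u :=
    ((contMDiffAt_vectorSpace_iff_contDiffAt (n := ∞)).2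
      (contDiff_maurerCartan_symm.clm_apply contDiff_const).contDiffAt).mdifferentiableAt (by simp)
  have hinv (x : M) (hx : x ∈ e.source) (w : NilVec n) :
      (mfderiv 𝓘(ℝ, NilVec n) 𝓘(ℝ, NilVec n) e x).inverse w =
        (coframe n x).symm (maurerCartan (e x) w) := by
    have h1 : mfderiv 𝓘(ℝ, NilVec n) 𝓘(ℝ, NilVec n) e x =
        ((coframe n x).trans (maurerCartan (e x)).symm : Tan (NilVec n) M x →L[ℝ] NilVec n) := by
      refine ContinuousLinearMap.ext fun v => ?_
      exact ((maurerCartan (e x)).eq_symm_apply.2 (coframe_eq he hx v).symm)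
    rw [h1]
    exact congrArg (fun f => f w) (ContinuousLinearMap.inverse_equiv
      ((coframe n x).trans (maurerCartan (e x)).symm))
  -- Near `p` these fields are pullbacks by one fixed chart of left-invariant fields on `N`, so
  -- naturality of the bracket reduces the claim to `N`.
  have hpull (v : NilVec n) : (fun x : M => (coframe n x).symm v) =ᶠ[𝓝 p]
      VectorField.mpullback 𝓘(ℝ, NilVec n) 𝓘(ℝ, NilVec n) e (fun u => (maurerCartan u).symm v) := by
    filter_upwards [eventually_mem_chart_source (n := n) p] with x hx
    exact ((hinv x hx _).trans (by rw [ContinuousLinearEquiv.apply_symm_apply])).symm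
  rw [(hpull v).mlieBracket_vectorField_eq (hpull w),
    ← VectorField.mpullback_mlieBracket (n := ∞) (hV v _) (hV w _) (contMDiffAt_chart p)
      (by rw [minSmoothness_of_isRCLikeNormedField]; exact ENat.LEInfty.out)]
  refine (hinv p (mem_chart_source _ p) _).trans ?_
  refine (congrArg (fun z => (coframe n p).symm (maurerCartan (e p) z))
    (mlieBracket_maurerCartan_symm v w (e p))).trans ?_
  congr 1
  rw [map_smul, maurerCartan_apply, omega_center]
  simp

end

end HKT

end

/-! ### The HKT connection and its torsion. -/

noncomputable section

namespace HKT

open NilVec Filter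
open scoped Topology

theorem MDifferentiableAt.mvfderiv_clm_apply {E F G M : Type} [NormedAddCommGroup E]
    [NormedSpace ℝ E] [NormedAddCommGroup F] [NormedSpace ℝ F] [NormedAddCommGroup G]
    [NormedSpace ℝ G] [TopologicalSpace M] [ChartedSpace E M] {f : M → F} {x : M}
    (hf : MDifferentiableAt 𝓘(ℝ, E) 𝓘(ℝ, F) f x) (L : F →L[ℝ] G) (v : TangentSpace 𝓘(ℝ, E) x) :
    mvfderiv 𝓘(ℝ, E) (fun y => L (f y)) x v = L (mvfderiv 𝓘(ℝ, E) f x v) := by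
  have h := (L.hasFDerivAt (x := f x)).hasMFDerivAt.comp x hf.hasMFDerivAt
  have h' : mfderiv 𝓘(ℝ, E) 𝓘(ℝ, G) (fun y => L (f y)) x = _ := h.mfderiv
  rw [mvfderiv, h']
  rfl

theorem MDifferentiableAt.mvfderiv_bilin_apply {E F M : Type} [NormedAddCommGroup E]
    [NormedSpace ℝ E] [NormedAddCommGroup F] [NormedSpace ℝ F]
    [TopologicalSpace M] [ChartedSpace E M] {f g : M → F} {x : M}
    (hf : MDifferentiableAt 𝓘(ℝ, E) 𝓘(ℝ, F) f x) (hg : MDifferentiableAt 𝓘(ℝ, E) 𝓘(ℝ, F) g x)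
    (B : F →L[ℝ] F →L[ℝ] ℝ) (v : TangentSpace 𝓘(ℝ, E) x) :
    mvfderiv 𝓘(ℝ, E) (fun y => B (f y) (g y)) x v =
      B (mvfderiv 𝓘(ℝ, E) f x v) (g x) + B (f x) (mvfderiv 𝓘(ℝ, E) g x v) := by
  have h1 := (B.isBoundedBilinearMap.hasFDerivAt (f x, g x)).hasMFDerivAt
  rw [modelWithCornersSelf_prod, ← chartedSpaceSelf_prod] at h1
  have h2 := hf.hasMFDerivAt.prodMk hg.hasMFDerivAt
  have h3 := h1.comp x h2
  have h' : mfderiv 𝓘(ℝ, E) 𝓘(ℝ, ℝ) (fun y => B (f y) (g y)) x = _ := h3.mfderiv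
  rw [mvfderiv, h']
  exact add_comm (B (f x) (mvfderiv 𝓘(ℝ, E) g x v)) (B (mvfderiv 𝓘(ℝ, E) f x v) (g x))

section

variable {n : ℕ} {M : Type} [TopologicalSpace M] [ChartedSpace (NilVec n) M]

/-- The covariant derivative of `nilConnection`. -/
def covDeriv (Y : (x : M) → Tan (NilVec n) M x) (x : M) :
    Tan (NilVec n) M x →L[ℝ] Tan (NilVec n) M x :=
  ((coframe n x).symm : NilVec n →L[ℝ] Tan (NilVec n) M x).comp
    (mvfderiv 𝓘(ℝ, NilVec n) (fun y => coframe n y (Y y)) x -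
      (theta.comp (coframe n x : Tan (NilVec n) M x →L[ℝ] NilVec n)).smulRight
        (rot (coframe n x (Y x))))

theorem coframe_covDeriv (Y : (x : M) → Tan (NilVec n) M x) (x : M) (v : Tan (NilVec n) M x) :
    coframe n x (covDeriv Y x v) = mvfderiv 𝓘(ℝ, NilVec n) (fun y => coframe n y (Y y)) x v -
      theta (coframe n x v) • rot (coframe n x (Y x)) :=
  (coframe n x).apply_symm_apply _

variable [IsManifold 𝓘(ℝ, NilVec n) ∞ M] [hM : IsNilStructure n M]

variable (n M) in
/-- The left-invariant connection with `∇_v w = -θ(v) J w` for left-invariant `v`, `w`. -/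
def nilConnection : Connection (NilVec n) M where
  toFun := covDeriv
  isCovariantDerivativeOnUniv :=
    { add := fun {Y Y' x} hY hY' _ => by
        refine ContinuousLinearMap.ext fun v => (coframe n x).injective ?_
        have e : (fun y => coframe n y ((Y + Y') y)) =
          fun y => coframe n y (Y y) + coframe n y (Y' y) := funext fun y => map_add _ _ _
        rw [_root_.add_apply, map_add, coframe_covDeriv, coframe_covDeriv, coframe_covDeriv, e,
          mvfderiv_fun_add (mdifferentiableAt_coframe_apply hY)
            (mdifferentiableAt_coframe_apply hY'), Pi.add_apply, map_add, map_add,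
          _root_.add_apply]
        module
      leibniz := fun {Y g x} hY hg _ => by
        refine ContinuousLinearMap.ext fun v => (coframe n x).injective ?_
        have e : (fun y => coframe n y ((g • Y) y)) =
          fun y => g y • coframe n y (Y y) :=
          funext fun y => map_smul (coframe n y) (g y) (Y y)
        rw [_root_.add_apply, map_add, _root_.smul_apply, map_smul, coframe_covDeriv,
          coframe_covDeriv, e, mvfderiv_fun_smul hg (mdifferentiableAt_coframe_apply hY),
          ContinuousLinearMap.smulRight_apply, map_smul, Pi.smul_apply', map_smul, map_smul,
          _root_.add_apply, _root_.smul_apply, ContinuousLinearMap.smulRight_apply]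
        module }

theorem nilConnection_apply (Y : (x : M) → Tan (NilVec n) M x) (x : M) :
    nilConnection n M Y x = covDeriv Y x := rfl

theorem preservesMetric_nilConnection : PreservesMetric (nilConnection n M) (nilMetric n M) := by
  intro x Y Z hY hZ v
  simp only [nilMetric_apply, nilConnection_apply, coframe_covDeriv]
  rw [MDifferentiableAt.mvfderiv_bilin_apply (mdifferentiableAt_coframe_apply hY)
    (mdifferentiableAt_coframe_apply hZ)]
  simp only [map_sub, map_smul, _root_.sub_apply, _root_.smul_apply, inner₀_rot,
    inner₀_comm _ (rot _), smul_eq_mul]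
  rw [omega_swap (coframe n x (Z x))]
  ring

theorem preservesEndo_nilConnection (a : Fin 3) :
    PreservesEndo (nilConnection n M) (quatField n M a) := by
  intro x Y hY v
  refine (coframe n x).injective ?_
  simp only [nilConnection_apply, coframe_covDeriv, coframe_quatField]
  rw [MDifferentiableAt.mvfderiv_clm_apply (mdifferentiableAt_coframe_apply hY), map_sub,
    map_smul, rot_quat]

theorem coframe_torsion (x : M) (v w : Tan (NilVec n) M x) :
    coframe n x ((nilConnection n M).torsion x v w) =
      -(theta (coframe n x v) • rot (coframe n x w)) + theta (coframe n x w) • rot (coframe n x v) -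
        omega (coframe n x v) (coframe n x w) • center := by
  -- Torsion is a tensor, so `v` and `w` may be extended with constant coframe components; the
  -- derivative terms then vanish and only `-θ ⊗ J` and the bracket remain.
  have h := (nilConnection n M).torsion_apply (diffAt_coframe_symm (coframe n x v) x)
    (diffAt_coframe_symm (coframe n x w) x)
  rw [mlieBracket_coframe_symm] at h
  simp only [ContinuousLinearEquiv.symm_apply_apply] at h
  rw [h, map_sub, map_sub, nilConnection_apply, nilConnection_apply, coframe_covDeriv,
    coframe_covDeriv]
  simp only [ContinuousLinearEquiv.symm_apply_apply, ContinuousLinearEquiv.apply_symm_apply,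
    mvfderiv_const, _root_.zero_apply]
  module

theorem hasSkewTorsion_nilConnection : HasSkewTorsion (nilConnection n M) (nilMetric n M) := by
  intro x u v w
  simp only [nilMetric_apply, coframe_torsion, inner₀_torsion]
  constructor
  · rw [omega_swap _ (coframe n x u), omega_swap (coframe n x v) (coframe n x w),
      omega_swap (coframe n x v) (coframe n x u)]
    ring
  · rw [omega_swap (coframe n x v) (coframe n x u), omega_swap (coframe n x w) (coframe n x u),
      omega_swap (coframe n x w) (coframe n x v)]
    ring

theorem contMDiff_nilConnection :
    CovariantDerivative.ContMDiffCovariantDerivative (nilConnection n M) ∞ where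
  contMDiff :=
    { contMDiff := fun {Y} hY p _ => by
        refine ContMDiffAt.contMDiffWithinAt (contMDiffAt_coframe_symm_comp ?_)
        have hY' : ContMDiffAt 𝓘(ℝ, NilVec n) 𝓘(ℝ, NilVec n) ∞
            (fun x => coframe n x (Y x)) p :=
          contMDiffAt_coframe_apply le_rfl
            (((hY p (Set.mem_univ p)).contMDiffAt univ_mem).of_le (by simp))
        have hd := hY'.mfderiv_const (m := ∞) (by simp)
        have h1 : ContMDiffAt 𝓘(ℝ, NilVec n) 𝓘(ℝ, NilVec n →L[ℝ] NilVec n) ∞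
            (fun x => (mvfderiv 𝓘(ℝ, NilVec n) (fun y => coframe n y (Y y)) x).comp
              ((trivializationAt (NilVec n) (Tan (NilVec n) M) p).symmL ℝ x)) p := by
          refine hd.congr_of_eventuallyEq (Eventually.of_forall fun x => ?_)
          refine ContinuousLinearMap.ext fun w => ?_
          simp only [inTangentCoordinates, ContinuousLinearMap.inCoordinates,
            TangentBundle.continuousLinearMapAt_model_space]
          rfl
        have hθ : ContDiff ℝ ∞ fun q : (NilVec n →L[ℝ] NilVec n) × NilVec n =>
            (theta.comp q.1).smulRight (rot q.2) := by
          have : ContDiff ℝ ∞ fun q : (NilVec n →L[ℝ] NilVec n) × NilVec n =>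
              ContinuousLinearMap.smulRightL ℝ (NilVec n) (NilVec n) (theta.comp q.1) (rot q.2) :=
            (ContDiff.clm_apply ((ContinuousLinearMap.contDiff _).comp
              (contDiff_const.clm_comp contDiff_fst)) (rot.contDiff.comp contDiff_snd))
          exact this
        have h2 := hθ.contMDiff.contMDiffAt.comp p
          ((contMDiffAt_coframe_symmL (n := n) p).prodMk_space hY')
        refine (h1.sub h2).congr_of_eventuallyEq (Eventually.of_forall fun x => ?_)
        exact ContinuousLinearMap.ext fun w => rfl }

theorem isHKT_quatField : IsHKT (E := NilVec n) (quatField n M) (nilMetric n M) :=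
  ⟨isHyperHermitian_quatField, nilConnection n M,
    { smooth := contMDiff_nilConnection
      metric := preservesMetric_nilConnection
      endo := preservesEndo_nilConnection
      skew := hasSkewTorsion_nilConnection }⟩

end

end HKT

end

noncomputable section

namespace HKT

open NilVec Filter
open scoped Topology

/-! ### The group `N` -/

theorem NilVec.lmul_eq {n : ℕ} (u w : NilVec n) :
    lmul u w = ((u.1.1 + w.1.1, u.1.2.1 + w.1.2.1,
      u.1.2.2 + w.1.2.2 + (∑ i, (u.1.1 i * w.1.2.1 i - u.1.2.1 i * w.1.1 i)) / 2),
      u.2 + w.2) := by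
  refine Prod.ext (Prod.ext ?_ (Prod.ext ?_ ?_)) ?_ <;> simp [lmul, center, omega_apply]

namespace NilGroup

variable {n : ℕ}

instance : T2Space (NilGroup n) := inferInstanceAs (T2Space (NilVec n))

instance : LocallyCompactSpace (NilGroup n) := inferInstanceAs (LocallyCompactSpace (NilVec n))

instance : IsTopologicalGroup (NilGroup n) :=
  topologicalGroup_of_lieGroup 𝓘(ℝ, NilVec n) ∞

instance : IsNilStructure n (NilGroup n) where
  exists_lmul e he e' he' x _ _ := by
    obtain rfl : e = OpenPartialHomeomorph.refl (NilVec n) := he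
    obtain rfl : e' = OpenPartialHomeomorph.refl (NilVec n) := he'
    exact ⟨0, Eventually.of_forall fun y => by simp [lmul]⟩

theorem mul_eq_lmul (a x : NilGroup n) : a * x = lmul (n := n) a x :=
  (lmul_eq (n := n) a x).symm

theorem coframe_apply (x : NilGroup n) (v : Tan (NilVec n) (NilGroup n) x) :
    coframe n x v = maurerCartan (n := n) x v := rfl

theorem mfderiv_mul_left (a x : NilGroup n) (v : Tan (NilVec n) (NilGroup n) x) :
    mfderiv 𝓘(ℝ, NilVec n) 𝓘(ℝ, NilVec n) (fun y => a * y) x v =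
      ((show NilVec n from v) + (1 / 2 : ℝ) • omega (n := n) a v • center : NilVec n) := by
  have h : HasMFDerivAt 𝓘(ℝ, NilVec n) 𝓘(ℝ, NilVec n) (fun y : NilGroup n => a * y) x
      (ContinuousLinearMap.id ℝ (NilVec n) +
        (1 / 2 : ℝ) • (omega (n := n) a).smulRight center : NilVec n →L[ℝ] NilVec n) := by
    rw [funext (mul_eq_lmul a)]
    exact (hasFDerivAt_lmul (n := n) a x).hasMFDerivAt
  rw [h.mfderiv]
  rfl

theorem coframe_mfderiv_mul_left (a x : NilGroup n) (v : Tan (NilVec n) (NilGroup n) x) :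
    coframe n (a * x) (mfderiv 𝓘(ℝ, NilVec n) 𝓘(ℝ, NilVec n) (fun y => a * y) x v) =
      coframe n x v := by
  refine (coframe_apply (a * x) _).trans ?_
  rw [mfderiv_mul_left]
  refine Eq.trans ?_ (maurerCartan_lmul (n := n) a x v)
  exact congrArg (fun u : NilVec n => maurerCartan u _) (mul_eq_lmul a x)

theorem isLeftInvariant_quatField (a : Fin 3) :
    (quatField n (NilGroup n) a).IsLeftInvariant := fun b x v => by
  refine (coframe n (b * x)).injective ?_
  rw [coframe_mfderiv_mul_left, coframe_quatField, coframe_quatField, coframe_mfderiv_mul_left]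

theorem isLeftInvariantMetric_nilMetric :
    IsLeftInvariantMetric (nilMetric n (NilGroup n)) := fun b x v w => by
  rw [nilMetric_apply, nilMetric_apply, coframe_mfderiv_mul_left, coframe_mfderiv_mul_left]

/-- Left translations preserve the coframe, so left-invariant fields have constant coframe
components. This transfers the bracket computation to the Lie algebra of `N`. -/
theorem mulInvariantVectorField_eq (v : GroupLieAlgebra 𝓘(ℝ, NilVec n) (NilGroup n)) :
    mulInvariantVectorField (I := 𝓘(ℝ, NilVec n)) (G := NilGroup n) v =
      fun x => (coframe n x).symm (coframe n (1 : NilGroup n) v) := by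
  funext x
  refine (coframe n x).injective ?_
  rw [ContinuousLinearEquiv.apply_symm_apply]
  refine Eq.trans ?_ (coframe_mfderiv_mul_left x 1 v)
  exact congrArg (fun y : NilGroup n => maurerCartan (n := n) y
    (mfderiv 𝓘(ℝ, NilVec n) 𝓘(ℝ, NilVec n) (fun y => x * y) 1 v)) (mul_one x).symm

theorem bracket_eq (v w : GroupLieAlgebra 𝓘(ℝ, NilVec n) (NilGroup n)) :
    ⁅v, w⁆ = (coframe n (1 : NilGroup n)).symm
      (omega (coframe n (1 : NilGroup n) v) (coframe n (1 : NilGroup n) w) • center) := by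
  rw [GroupLieAlgebra.bracket_def, mulInvariantVectorField_eq, mulInvariantVectorField_eq]
  exact mlieBracket_coframe_symm _ _ _

theorem isAbelian_quatField (a : Fin 3) : (quatField n (NilGroup n) a).IsAbelian := fun v w => by
  rw [bracket_eq, bracket_eq, coframe_quatField, coframe_quatField, omega_quat]

end NilGroup

/-! ### The nilmanifold -/

instance {n : ℕ} : ContinuousMul (Heis n) where
  continuous_mul := by
    have h : Continuous fun p : ((Fin (2 * n) → ℝ) × (Fin (2 * n) → ℝ) × ℝ) ×
        ((Fin (2 * n) → ℝ) × (Fin (2 * n) → ℝ) × ℝ) =>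
        (p.1.1 + p.2.1, p.1.2.1 + p.2.2.1,
          p.1.2.2 + p.2.2.2 + (∑ i, (p.1.1 i * p.2.2.1 i - p.1.2.1 i * p.2.1 i)) / 2) := by
      fun_prop
    exact h

section Nilmanifold

variable {n : ℕ} (Γ : Subgroup (Heis n)) (Λ : Submodule ℤ (Fin 3 → ℝ))

namespace Nilmanifold

theorem isDiscrete_latticeProd [DiscreteTopology Γ] [DiscreteTopology Λ] :
    IsDiscrete (latticeProd Γ Λ : Set (NilGroup n)) := by
  let f : latticeProd Γ Λ → Γ × Λ := fun p => (⟨p.1.1, p.2.1⟩, ⟨p.1.2, p.2.2⟩)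
  have hp : Continuous fun p : latticeProd Γ Λ => (p : NilGroup n) := continuous_subtype_val
  have hf : Continuous f :=
    ((continuous_fst.comp hp).subtype_mk _).prodMk ((continuous_snd.comp hp).subtype_mk _)
  have : DiscreteTopology (latticeProd Γ Λ) :=
    .of_continuous_injective hf fun p q h => Subtype.ext (Prod.ext
      (congrArg Subtype.val (congrArg Prod.fst h)) (congrArg Subtype.val (congrArg Prod.snd h)))
  exact ⟨this⟩

theorem proj_eq_proj_iff {x y : NilGroup n} :
    proj Γ Λ x = proj Γ Λ y ↔ ∃ γ ∈ latticeProd Γ Λ, γ * y = x := by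
  refine Quotient.eq''.trans (Iff.trans (MulAction.orbitRel_apply) ?_)
  exact ⟨fun ⟨γ, h⟩ => ⟨γ, γ.2, h⟩, fun ⟨γ, hγ, h⟩ => ⟨⟨γ, hγ⟩, h⟩⟩

theorem isQuotientMap_proj : Topology.IsQuotientMap (proj Γ Λ) := isQuotientMap_quotient_mk'

theorem compactSpace [CompactSpace (MulAction.orbitRel.Quotient Γ (Heis n))]
    [DiscreteTopology Λ] [IsZLattice ℝ Λ] : CompactSpace (Nilmanifold Γ Λ) := by
  let q₁ : Heis n → MulAction.orbitRel.Quotient Γ (Heis n) := Quotient.mk _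
  let q₂ : (Fin 3 → ℝ) → (Fin 3 → ℝ) ⧸ Λ.toAddSubgroup := QuotientAddGroup.mk
  have hq₁ : IsOpenQuotientMap q₁ := MulAction.isOpenQuotientMap_quotientMk
  have hq₂ : IsOpenQuotientMap q₂ := QuotientAddGroup.isOpenQuotientMap_mk
  have : CompactSpace ((Fin 3 → ℝ) ⧸ Λ.toAddSubgroup) := by
    rw [← isCompact_univ_iff, ← hq₂.surjective.range_eq]
    refine IsZLattice.isCompact_range_of_periodic Λ q₂ hq₂.continuous fun z w hw => ?_
    exact (QuotientAddGroup.mk_add_of_mem z hw)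
  let f : MulAction.orbitRel.Quotient Γ (Heis n) × ((Fin 3 → ℝ) ⧸ Λ.toAddSubgroup) →
      Nilmanifold Γ Λ := fun p => proj Γ Λ ((p.1.out, p.2.out) : NilVec n)
  -- The chosen representatives differ from the original points by elements of `Γ` and `Λ`, so `f`
  -- is the map induced by the projection. It exhibits the quotient as a continuous image of a
  -- product of compact spaces.
  have hf : f ∘ Prod.map q₁ q₂ = fun p => proj Γ Λ p := by
    funext p
    refine (proj_eq_proj_iff Γ Λ).2 ?_
    obtain ⟨γ, hγ⟩ : ∃ γ : Γ, γ • p.1 = (q₁ p.1).out :=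
      MulAction.orbitRel_apply.1 (Quotient.mk_out (s := MulAction.orbitRel Γ (Heis n)) p.1)
    obtain ⟨l, hl⟩ := QuotientAddGroup.mk_out_eq_add Λ.toAddSubgroup p.2
    exact ⟨(γ.1, (l : Fin 3 → ℝ)), ⟨γ.2, l.2⟩, Prod.ext hγ ((add_comm _ _).trans hl.symm)⟩
  have hfc : Continuous f := by
    rw [(hq₁.prodMap hq₂).isQuotientMap.continuous_iff, hf]
    exact (isQuotientMap_proj Γ Λ).continuous
  have hfs : Function.Surjective f := by
    refine Function.Surjective.of_comp (g := Prod.map q₁ q₂) ?_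
    rw [hf]
    exact (isQuotientMap_proj Γ Λ).surjective
  exact hfs.compactSpace hfc

variable [DiscreteTopology Γ] [DiscreteTopology Λ]

theorem t2Space : T2Space (Nilmanifold Γ Λ) := by
  have := Subgroup.properlyDiscontinuousSMul_of_tendsto_cofinite (latticeProd Γ Λ)
    ((latticeProd Γ Λ).tendsto_coe_cofinite_of_discrete (isDiscrete_latticeProd Γ Λ))
  exact t2Space_of_properlyDiscontinuousSMul_of_t2Space

theorem isLocalHomeomorph_proj : IsLocalHomeomorph (proj Γ Λ) := by
  have h : IsQuotientCoveringMap (proj Γ Λ) (latticeProd Γ Λ) :=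
    (isQuotientMap_proj Γ Λ).isQuotientCoveringMap_of_subgroup _
      (isDiscrete_latticeProd Γ Λ) fun {x y} => by
        rw [eq_comm, proj_eq_proj_iff]
        exact ⟨fun ⟨γ, hγ, h⟩ => by rwa [← h, mul_inv_cancel_right], fun h => ⟨_, h, by simp⟩⟩
  exact h.isCoveringMap.isLocalHomeomorph

/-- A local inverse of the projection, defined around the point `q`. -/
def localSection (q : Nilmanifold Γ Λ) : OpenPartialHomeomorph (Nilmanifold Γ Λ) (NilVec n) :=
  (isLocalHomeomorph_proj Γ Λ ((isQuotientMap_proj Γ Λ).surjective q).choose).choose.symm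

theorem mem_localSection_source (q : Nilmanifold Γ Λ) : q ∈ (localSection Γ Λ q).source := by
  have h := (isLocalHomeomorph_proj Γ Λ
    ((isQuotientMap_proj Γ Λ).surjective q).choose).choose_spec
  have h' := OpenPartialHomeomorph.map_source _ h.1
  rw [← h.2, ((isQuotientMap_proj Γ Λ).surjective q).choose_spec] at h'
  exact h'

theorem localSection_symm (q : Nilmanifold Γ Λ) :
    ⇑(localSection Γ Λ q).symm = proj Γ Λ :=
  (isLocalHomeomorph_proj Γ Λ ((isQuotientMap_proj Γ Λ).surjective q).choose).choose_spec.2.symm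

/-- The smooth structure of the nilmanifold: the charts are the local inverses of the
projection. -/
@[reducible]
def chartedSpace : ChartedSpace (NilVec n) (Nilmanifold Γ Λ) where
  -- Every local inverse is admitted, not only the chosen sections, so that `exists_chart` can find
  -- a chart inverting the projection near any prescribed point of `N`.
  atlas := {e | ⇑e.symm = proj Γ Λ}
  chartAt := localSection Γ Λ
  mem_chart_source := mem_localSection_source Γ Λ
  chart_mem_atlas := localSection_symm Γ Λ

attribute [local instance] chartedSpace

theorem isNilStructure : IsNilStructure n (Nilmanifold Γ Λ) where
  exists_lmul e he e' he' x hx hx' := by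
    have he : ⇑e.symm = proj Γ Λ := he
    have he' : ⇑e'.symm = proj Γ Λ := he'
    obtain ⟨γ, hγ, h⟩ : ∃ γ ∈ latticeProd Γ Λ, γ * (show NilGroup n from e x) = e' x := by
      refine (proj_eq_proj_iff Γ Λ).1 ?_
      exact (congrFun he' (e' x)).symm.trans ((e'.left_inv hx').trans
        ((e.left_inv hx).symm.trans (congrFun he (e x))))
    have h' : lmul (n := n) γ (e x) = e' x := (NilGroup.mul_eq_lmul _ _).symm.trans h
    refine ⟨γ, ?_⟩
    -- The translation is fixed by its value at `x`. For `y` near `x`, continuity keeps `γ * e y` in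
    -- the target of `e'`, and it projects to `y`; injectivity of the projection on that target
    -- forces it to equal `e' y`.
    have hc : Tendsto (fun y => lmul (n := n) γ (e y)) (𝓝 x) (𝓝 (e' x)) := by
      rw [← h']
      exact (contDiff_lmul γ).continuous.continuousAt.tendsto.comp (e.continuousAt hx)
    filter_upwards [hc.eventually (e'.open_target.mem_nhds (e'.map_source hx')),
      e.open_source.mem_nhds hx, e'.open_source.mem_nhds hx'] with y hy hy1 hy2
    rw [← e'.right_inv hy]
    refine congrArg e' ?_
    refine (e.left_inv hy1).symm.trans ((congrFun he _).trans (Eq.trans ?_ (congrFun he' _).symm))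
    exact ((proj_eq_proj_iff Γ Λ).2 ⟨γ, hγ, NilGroup.mul_eq_lmul _ _⟩).symm

attribute [local instance] isNilStructure

theorem isManifold : IsManifold 𝓘(ℝ, NilVec n) ∞ (Nilmanifold Γ Λ) :=
  (isNilStructure Γ Λ).isManifold

attribute [local instance] isManifold

theorem exists_chart (x : NilGroup n) : ∃ e ∈ atlas (NilVec n) (Nilmanifold Γ Λ),
    proj Γ Λ x ∈ e.source ∧ ∀ᶠ y in 𝓝 x, e (proj Γ Λ y) = y := by
  obtain ⟨e, hx, he⟩ := isLocalHomeomorph_proj Γ Λ x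
  refine ⟨e.symm, he.symm, ?_, ?_⟩
  · rw [he]
    exact e.map_source hx
  · filter_upwards [e.open_source.mem_nhds hx] with y hy
    rw [he]
    exact e.left_inv hy

theorem isLocalDiffeomorph_proj :
    IsLocalDiffeomorph 𝓘(ℝ, NilVec n) 𝓘(ℝ, NilVec n) ∞ (proj Γ Λ) := fun x => by
  obtain ⟨e, hx, he⟩ := isLocalHomeomorph_proj Γ Λ x
  have hm : e.symm ∈ IsManifold.maximalAtlas 𝓘(ℝ, NilVec n) ∞ (Nilmanifold Γ Λ) :=
    IsManifold.subset_maximalAtlas he.symm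
  exact ⟨{ e.toPartialEquiv with
    open_source := e.open_source
    open_target := e.open_target
    contMDiffOn_toFun := contMDiffOn_symm_of_mem_maximalAtlas hm
    contMDiffOn_invFun := contMDiffOn_of_mem_maximalAtlas hm }, hx, fun y _ => congrFun he y⟩

/-- Some atlas chart composed with the projection is the identity near `x`, and `coframe_eq` permits
computing the coframe of the quotient in that chart. -/
theorem coframe_mfderiv_proj (x : NilGroup n) (v : Tan (NilVec n) (NilGroup n) x) :
    coframe n (proj Γ Λ x) (mfderiv 𝓘(ℝ, NilVec n) 𝓘(ℝ, NilVec n) (proj Γ Λ) x v) =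
      coframe n x v := by
  obtain ⟨e, he, hx, h⟩ := exists_chart Γ Λ x
  refine (coframe_eq he hx _).trans ?_
  have h1 : MDifferentiableAt 𝓘(ℝ, NilVec n) 𝓘(ℝ, NilVec n) (proj Γ Λ) x :=
    (isLocalDiffeomorph_proj Γ Λ).contMDiff.contMDiffAt.mdifferentiableAt (by simp)
  have h2 : MDifferentiableAt 𝓘(ℝ, NilVec n) 𝓘(ℝ, NilVec n) e (proj Γ Λ x) :=
    mdifferentiableAt_atlas he hx
  have h3 : HasMFDerivAt 𝓘(ℝ, NilVec n) 𝓘(ℝ, NilVec n) (fun y : NilGroup n => e (proj Γ Λ y)) x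
      (ContinuousLinearMap.id ℝ (NilVec n)) :=
    (hasMFDerivAt_id (I := 𝓘(ℝ, NilVec n)) (M := NilGroup n) x).congr_of_eventuallyEq h
  have h4 := congrArg (fun L : NilVec n →L[ℝ] NilVec n => L v)
    (hasMFDerivAt_unique (h2.hasMFDerivAt.comp x h1.hasMFDerivAt) h3)
  exact congrArg₂ (fun u w : NilVec n => maurerCartan u w) h.self_of_nhds h4

theorem mfderiv_proj_quatField (a : Fin 3) (x : NilGroup n)
    (v : Tan (NilVec n) (NilGroup n) x) :
    mfderiv 𝓘(ℝ, NilVec n) 𝓘(ℝ, NilVec n) (proj Γ Λ) x (quatField n (NilGroup n) a x v) =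
      quatField n (Nilmanifold Γ Λ) a (proj Γ Λ x)
        (mfderiv 𝓘(ℝ, NilVec n) 𝓘(ℝ, NilVec n) (proj Γ Λ) x v) := by
  refine (coframe n (proj Γ Λ x)).injective ?_
  rw [coframe_mfderiv_proj, coframe_quatField, coframe_quatField, coframe_mfderiv_proj]

theorem nilMetric_mfderiv_proj (x : NilGroup n) (v w : Tan (NilVec n) (NilGroup n) x) :
    (nilMetric n (Nilmanifold Γ Λ)).inner (proj Γ Λ x)
        (mfderiv 𝓘(ℝ, NilVec n) 𝓘(ℝ, NilVec n) (proj Γ Λ) x v)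
        (mfderiv 𝓘(ℝ, NilVec n) 𝓘(ℝ, NilVec n) (proj Γ Λ) x w) =
      (nilMetric n (NilGroup n)).inner x v w := by
  rw [nilMetric_apply, nilMetric_apply, coframe_mfderiv_proj, coframe_mfderiv_proj]

end Nilmanifold

end Nilmanifold

end HKT

end

theorem mainTheorem7 (n : ℕ)
    (Γ : Subgroup (HKT.Heis n)) [DiscreteTopology Γ]
    [CompactSpace (MulAction.orbitRel.Quotient Γ (HKT.Heis n))]
    (Λ : Submodule ℤ (Fin 3 → ℝ)) [DiscreteTopology Λ] [IsZLattice ℝ Λ] :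
    CompactSpace (HKT.Nilmanifold Γ Λ) ∧ T2Space (HKT.Nilmanifold Γ Λ) ∧
    -- the quotient smooth structure, the only one that makes the projection a local diffeomorphism
    ∃ (_ : ChartedSpace (HKT.NilVec n) (HKT.Nilmanifold Γ Λ))
      (_ : IsManifold 𝓘(ℝ, HKT.NilVec n) ∞ (HKT.Nilmanifold Γ Λ)),
      IsLocalDiffeomorph 𝓘(ℝ, HKT.NilVec n) 𝓘(ℝ, HKT.NilVec n) ∞ (HKT.Nilmanifold.proj Γ Λ) ∧
      ∃ (I : Fin 3 → HKT.EndoField (HKT.NilVec n) (HKT.Nilmanifold Γ Λ))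
        (g : HKT.Metric (HKT.NilVec n) (HKT.Nilmanifold Γ Λ)),
        HKT.IsHKT I g ∧
        -- it is induced by left-invariant tensors on `N`, with Abelian complex structures
        ∃ (I' : Fin 3 → HKT.EndoField (HKT.NilVec n) (HKT.NilGroup n))
          (g' : HKT.Metric (HKT.NilVec n) (HKT.NilGroup n)),
          (∀ a, (I' a).IsLeftInvariant) ∧ (∀ a, (I' a).IsAbelian) ∧
          HKT.IsLeftInvariantMetric g' ∧
          (∀ (a : Fin 3) (x : HKT.NilGroup n) (v : HKT.Tan (HKT.NilVec n) (HKT.NilGroup n) x),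
            mfderiv 𝓘(ℝ, HKT.NilVec n) 𝓘(ℝ, HKT.NilVec n) (HKT.Nilmanifold.proj Γ Λ) x (I' a x v) =
              I a (HKT.Nilmanifold.proj Γ Λ x)
                (mfderiv 𝓘(ℝ, HKT.NilVec n) 𝓘(ℝ, HKT.NilVec n) (HKT.Nilmanifold.proj Γ Λ) x v)) ∧
          (∀ (x : HKT.NilGroup n) (v w : HKT.Tan (HKT.NilVec n) (HKT.NilGroup n) x),
            g.inner (HKT.Nilmanifold.proj Γ Λ x)
              (mfderiv 𝓘(ℝ, HKT.NilVec n) 𝓘(ℝ, HKT.NilVec n) (HKT.Nilmanifold.proj Γ Λ) x v)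
              (mfderiv 𝓘(ℝ, HKT.NilVec n) 𝓘(ℝ, HKT.NilVec n) (HKT.Nilmanifold.proj Γ Λ) x w) =
              g'.inner x v w) := by
  let _ := HKT.Nilmanifold.chartedSpace Γ Λ
  have := HKT.Nilmanifold.isNilStructure Γ Λ
  have := HKT.Nilmanifold.isManifold Γ Λ
  exact ⟨HKT.Nilmanifold.compactSpace Γ Λ, HKT.Nilmanifold.t2Space Γ Λ, inferInstance,
    inferInstance, HKT.Nilmanifold.isLocalDiffeomorph_proj Γ Λ,
    HKT.quatField n (HKT.Nilmanifold Γ Λ), HKT.nilMetric n (HKT.Nilmanifold Γ Λ),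
    HKT.isHKT_quatField, HKT.quatField n (HKT.NilGroup n), HKT.nilMetric n (HKT.NilGroup n),
    HKT.NilGroup.isLeftInvariant_quatField, HKT.NilGroup.isAbelian_quatField,
    HKT.NilGroup.isLeftInvariantMetric_nilMetric, HKT.Nilmanifold.mfderiv_proj_quatField Γ Λ,
    HKT.Nilmanifold.nilMetric_mfderiv_proj Γ Λ⟩
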